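/- For a space curve $s:\mathbb R\to\mathbb R^3$ let $\kappa=\|s'\times s''\|/\|s'\|^3$ be its curvature and $\tau=-\langle s'\times s'',s'''\rangle/\|s'\times s''\|^2$ its torsion. Identify $\mathbb R^3$ with the imaginary quaternions, and write $\operatorname{cr}(a,b,c,d)=(a-b)(b-c)^{-1}(c-d)(d-a)^{-1}$ for $a,b,c,d\in\mathbb H$. For $q=|q|[\cos\varphi,v\sin\varphi]\in\mathbb H\setminus\mathbb R_{\le 0}$ with $\|v\|=1$, $\varphi\in[0,\pi)$, put $\sqrt q=\sqrt{|q|}\,[\cos\frac\varphi2,v\sin\frac\varphi2]$. For four pairwise distinct points $a,b,c,d\in\mathbb R^3$ put $$f(a,b,c,d)=(w+1)^{-1}(wc+b),\qquad w=(b-a)(c-a)^{-1}\sqrt{\operatorname{cr}(c,a,b,d)}.$$ Let $\gamma:\mathbb Z\to\mathbb R^3$ be a discrete curve and $a=\gamma_{i-1}$, $b=\gamma_i$, $c=\gamma_{i+1}$, $d=\gamma_{i+2}$. The discrete curvature circle $k_i$ is the circle through the four points $p_{ab}=f(d,a,b,c)$, $p_{bc}=f(a,b,c,d)$, $p_{cd}=f(b,c,d,a)$,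 $p_{da}=f(c,d,a,b)$. Let $m_i$ be its center, $\kappa_i$ the inverse of its radius, and $N_i=(m_i-p_{bc})/\|m_i-p_{bc}\|$ its unit normal at $p_{bc}$ pointing towards the center. The discrete torsion is $$\tau_i=-\frac{9\,\langle \operatorname{Im}\operatorname{cr}(\gamma_{i-1},\gamma_i,\gamma_{i+1},\gamma_{i+2}),N_i\rangle}{2\,\kappa_i\,\|\gamma_i-\gamma_{i+1}\|^2}.$$ **Theorem.** Let $s:\mathbb R\to\mathbb R^3$ be of class $C^5$ and let $u\in\mathbb R$ with $s'(u)\times s''(u)\ne 0$ (that is, $s'(u)\neq0$ and $\kappa(u)\ne0$). For $\varepsilon\ne0$ let $\gamma_k=s(u+(2k-1)\varepsilon)$, $k\in\mathbb Z$. Then for all sufficiently small $\varepsilon\neq 0$ the points $p_{ab},p_{bc},p_{cd},p_{da}$ for $i=0$ are well-defined points of $\mathbb R^3$ (the four vertices $\gamma_{-1},\gamma_0,\gamma_1,\gamma_2$ are pairwise distinct, no cross-ratio under a square root is a negative real number, no factor to be inverted vanishes, and the values are imaginary quaternions), there is exactly one circle through them, and $$\tau_0=\tau(u)+O(\varepsilon^2)\qquad(\varepsilon\to0).$$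 -/

import Mathlib

open Asymptotics
open scoped Topology Quaternion

noncomputable section

namespace DiscreteTorsion

/-- Euclidean three-space. -/
abbrev E3 := EuclideanSpace ℝ (Fin 3)

/-- The cross product on Euclidean three-space. -/
def cross (v w : E3) : E3 := WithLp.toLp 2 (crossProduct v.ofLp w.ofLp)

/-- The curvature `κ = ‖s' × s''‖ / ‖s'‖³` of a space curve. It vanishes by convention where
`s' = 0`, so `κ ≠ 0` says that `s'` and `s''` are linearly independent. -/
def curvature (s : ℝ → E3) (u : ℝ) : ℝ :=
  ‖cross (deriv s u) (iteratedDeriv 2 s u)‖ / ‖deriv s u‖ ^ 3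

/-- The torsion `τ = -⟨s' × s'', s'''⟩ / ‖s' × s''‖²` of a space curve. -/
def torsion (s : ℝ → E3) (u : ℝ) : ℝ :=
  -(inner ℝ (cross (deriv s u) (iteratedDeriv 2 s u)) (iteratedDeriv 3 s u)) /
    ‖cross (deriv s u) (iteratedDeriv 2 s u)‖ ^ 2

/-- The identification of `ℝ³` with the imaginary quaternions, `v ↦ [0, v]`. -/
def toQuat (v : E3) : ℍ[ℝ] := ⟨0, v 0, v 1, v 2⟩

/-- The imaginary part of a quaternion, as a vector of `ℝ³`. -/
def imVec (q : ℍ[ℝ]) : E3 := !₂[q.imI, q.imJ, q.imK]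

/-- The quaternionic cross-ratio `(a - b) (b - c)⁻¹ (c - d) (d - a)⁻¹`. -/
def cr (a b c d : ℍ[ℝ]) : ℍ[ℝ] := (a - b) * (b - c)⁻¹ * (c - d) * (d - a)⁻¹

/-- The polar angle `φ ∈ [0, π]` of a quaternion `q = |q| [cos φ, v sin φ]`, `‖v‖ = 1`. -/
def polarAngle (q : ℍ[ℝ]) : ℝ := Real.arccos (q.re / ‖q‖)

/-- The principal square root `√|q| [cos (φ / 2), v sin (φ / 2)]` of `q = |q| [cos φ, v sin φ]`,
with `v = Im q / ‖Im q‖`. For positive real `q` one has `sin (φ / 2) = 0` and `v` is irrelevant;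
negative real `q` are excluded wherever the square root is used. -/
def qsqrt (q : ℍ[ℝ]) : ℍ[ℝ] :=
  (Real.sqrt ‖q‖ * Real.cos (polarAngle q / 2)) • (1 : ℍ[ℝ]) +
    (Real.sqrt ‖q‖ * Real.sin (polarAngle q / 2)) • toQuat (‖imVec q‖⁻¹ • imVec q)

/-- The coefficient `(b - a) (c - a)⁻¹ √cr(c, a, b, d)` of the point-insertion rule. -/
def insertCoeff (a b c d : ℍ[ℝ]) : ℍ[ℝ] := (b - a) * (c - a)⁻¹ * qsqrt (cr c a b d)

/-- The point-insertion rule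
`f(a,b,c,d) = ((b-a)(c-a)⁻¹√cr(c,a,b,d) + 1)⁻¹ ((b-a)(c-a)⁻¹√cr(c,a,b,d) c + b)`. -/
def insertPoint (a b c d : ℍ[ℝ]) : ℍ[ℝ] :=
  (insertCoeff a b c d + 1)⁻¹ * (insertCoeff a b c d * c + b)

/-- `f(a, b, c, d)` is a well-defined point of `ℝ³`: the four points are pairwise distinct, the
cross-ratio under the root is not a negative real number, the factor to be inverted does not
vanish, and the value is an imaginary quaternion. -/
def InsertPointDefined (a b c d : ℍ[ℝ]) : Prop :=
  (a ≠ b ∧ a ≠ c ∧ a ≠ d ∧ b ≠ c ∧ b ≠ d ∧ c ≠ d) ∧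
    ¬ (imVec (cr c a b d) = 0 ∧ (cr c a b d).re < 0) ∧
    insertCoeff a b c d + 1 ≠ 0 ∧
    (insertPoint a b c d).re = 0

/-- A circle of positive radius in three-space. -/
structure SpaceCircle where
  plane : AffineSubspace ℝ E3
  finrank_plane : Module.finrank ℝ plane.direction = 2
  center : E3
  center_mem : center ∈ plane
  radius : ℝ
  radius_pos : 0 < radius

/-- The points of a circle. -/
def SpaceCircle.points (C : SpaceCircle) : Set E3 :=
  {x | x ∈ C.plane ∧ dist x C.center = C.radius}

/-- The `k`-th vertex of a discrete curve as an imaginary quaternion. -/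
def vertex (γ : ℤ → E3) (k : ℤ) : ℍ[ℝ] := toQuat (γ k)

/-- The point `p_{ab} = f(d, a, b, c)`, where
`a = γ (i - 1)`, `b = γ i`, `c = γ (i + 1)`, `d = γ (i + 2)`. -/
def pAB (γ : ℤ → E3) (i : ℤ) : ℍ[ℝ] :=
  insertPoint (vertex γ (i + 2)) (vertex γ (i - 1)) (vertex γ i) (vertex γ (i + 1))

/-- The point `p_{bc} = f(a, b, c, d)`. -/
def pBC (γ : ℤ → E3) (i : ℤ) : ℍ[ℝ] :=
  insertPoint (vertex γ (i - 1)) (vertex γ i) (vertex γ (i + 1)) (vertex γ (i + 2))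

/-- The point `p_{cd} = f(b, c, d, a)`. -/
def pCD (γ : ℤ → E3) (i : ℤ) : ℍ[ℝ] :=
  insertPoint (vertex γ i) (vertex γ (i + 1)) (vertex γ (i + 2)) (vertex γ (i - 1))

/-- The point `p_{da} = f(c, d, a, b)`. -/
def pDA (γ : ℤ → E3) (i : ℤ) : ℍ[ℝ] :=
  insertPoint (vertex γ (i + 1)) (vertex γ (i + 2)) (vertex γ (i - 1)) (vertex γ i)

/-- `C` is a circle through the four points `p_{ab}, p_{bc}, p_{cd}, p_{da}`. -/
def IsCurvatureCircle (γ : ℤ → E3) (i : ℤ) (C : SpaceCircle) : Prop :=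
  imVec (pAB γ i) ∈ C.points ∧ imVec (pBC γ i) ∈ C.points ∧
    imVec (pCD γ i) ∈ C.points ∧ imVec (pDA γ i) ∈ C.points

/-- The discrete curvature circle at the edge `γ i, γ (i + 1)` is well defined: the four inserted
points are well-defined points of `ℝ³`, and there is exactly one circle through them. -/
def CurvatureCircleDefined (γ : ℤ → E3) (i : ℤ) : Prop :=
  InsertPointDefined (vertex γ (i + 2)) (vertex γ (i - 1)) (vertex γ i) (vertex γ (i + 1)) ∧
  InsertPointDefined (vertex γ (i - 1)) (vertex γ i) (vertex γ (i + 1)) (vertex γ (i + 2)) ∧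
  InsertPointDefined (vertex γ i) (vertex γ (i + 1)) (vertex γ (i + 2)) (vertex γ (i - 1)) ∧
  InsertPointDefined (vertex γ (i + 1)) (vertex γ (i + 2)) (vertex γ (i - 1)) (vertex γ i) ∧
  ∃! C : SpaceCircle, IsCurvatureCircle γ i C

open Classical in
/-- The discrete curvature `κ_i`: the inverse of the radius of the discrete curvature circle
(and `0` if there is no such circle). -/
def discreteCurvature (γ : ℤ → E3) (i : ℤ) : ℝ :=
  if h : ∃ C : SpaceCircle, IsCurvatureCircle γ i C then h.choose.radius⁻¹ else 0

open Classical in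
/-- The discrete unit normal `N_i`: the unit normal of the discrete curvature circle at `p_{bc}`
within the plane of the circle, oriented like the principal normal `N = B × T` of a smooth curve,
that is, towards the center of the circle (and `0` if there is no such circle). -/
def discreteNormal (γ : ℤ → E3) (i : ℤ) : E3 :=
  if h : ∃ C : SpaceCircle, IsCurvatureCircle γ i C then
    ‖h.choose.center - imVec (pBC γ i)‖⁻¹ • (h.choose.center - imVec (pBC γ i))
  else 0

/-- The discrete torsion
`τ_i = -9 ⟨Im cr(γ_{i-1}, γ_i, γ_{i+1}, γ_{i+2}), N_i⟩ / (2 κ_i ‖γ_i - γ_{i+1}‖²)`. -/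
def discreteTorsion (γ : ℤ → E3) (i : ℤ) : ℝ :=
  -(9 * inner ℝ
      (imVec (cr (vertex γ (i - 1)) (vertex γ i) (vertex γ (i + 1)) (vertex γ (i + 2))))
      (discreteNormal γ i)) /
    (2 * discreteCurvature γ i * ‖γ i - γ (i + 1)‖ ^ 2)

/-- The sampling `γ_k = s (u + (2 k - 1) ε)` of a smooth curve. -/
def sample (s : ℝ → E3) (u ε : ℝ) : ℤ → E3 := fun k => s (u + (2 * (k : ℝ) - 1) * ε)

end DiscreteTorsion

end

/-!
Write `a, b, c, d = γ₋₁, γ₀, γ₁, γ₂`. The rule `p = f(a, b, c, d)` says that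
`cr(c, a, b, p) = -√cr(c, a, b, d)`; by `insertPoint_of_cr` it is enough to exhibit an imaginary
point `p` for which `r = -cr(c, a, b, p)` satisfies `r² = cr(c, a, b, d)` and `Re r > 0`. This
criterion is invariant under inversions of `ℝ³`, because they conjugate cross-ratios
(`cr_sub_inv`).

*The circle.* The point `p_{bc}` is a fixed point of the involution that exchanges `b` with `c` and
`a` with `d` on the sphere through the four points. Inversion at `p_{bc}` turns this involution into
a point reflection, so that the images of `a, d` and of `b, c` are `x ± α` and `x ± β`, the vertices
of a parallelogram. Conversely, whenever inversion at a point `p` produces such a parallelogram with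
`‖α‖ < ‖β‖`, then `p_{bc} = p`, the image of `p_{da}` is `x`, and the images of `p_{ab}` and
`p_{cd}` are `x ± m` with `m` the bisector of `α` and `β` (`Parallelogram.insertPoint_bc`,
`Parallelogram.insertPoint_da`, `insertPoint_bisector`). These images lie on a line; hence there is
exactly one circle through the four points, and `κ N = 2 F`, where `F` is the foot of the
perpendicular from the origin to this line (`existsUnique_circle`,
`Parallelogram.curvatureCircle`).

*The expansion.* After a translation the sampled points are `b, c = ∓ε P` and
`a, d = ε² g ∓ 3 ε (P + ε² R)`, where `P`, `g`, `R` are even in `ε` and tend to `s'`, `4 s''`,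
`(4/3) s'''` up to `O(ε²)`. With `p_{bc} = ε² v` the parallelogram condition is an equation in
`P, R, g, v` and `η = ε²` alone. At `η = 0` it is linear and nondegenerate in `v`, so the implicit
function theorem gives `v` as a differentiable function of `(P, R, g, η)` (`exists_implicit_pBC`).
The foot `F` is a differentiable function of the same data, and the discrete torsion has the form
`torsionEven + ε torsionOdd` with both terms differentiable in the data
(`Admissible.discreteTorsion_eq`). In the limit the first equals the torsion, and the second
vanishes because the odd part of the imaginary cross-ratio is tangential. Since the data differ
from their limit by `O(ε²)` (`sampleData_sub_isBigO`), so does the torsion.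
-/

noncomputable section

namespace DiscreteTorsion

/-! ### Imaginary quaternions and vectors -/

/-- Inversion of `ℝ³` in the unit sphere, `v ↦ v / ‖v‖²`, with value `0` at `0`. -/
def vinv (v : E3) : E3 := (‖v‖ ^ 2)⁻¹ • v

theorem norm_sq_eq (v : E3) : ‖v‖ ^ 2 = v 0 ^ 2 + v 1 ^ 2 + v 2 ^ 2 := by
  simp [EuclideanSpace.norm_sq_eq, Fin.sum_univ_three]

theorem inner_eq (v w : E3) : inner ℝ v w = v 0 * w 0 + v 1 * w 1 + v 2 * w 2 := by
  simp [PiLp.inner_apply, Fin.sum_univ_three, mul_comm]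

@[simp] theorem toQuat_re (v : E3) : (toQuat v).re = 0 := rfl
@[simp] theorem toQuat_imI (v : E3) : (toQuat v).imI = v 0 := rfl
@[simp] theorem toQuat_imJ (v : E3) : (toQuat v).imJ = v 1 := rfl
@[simp] theorem toQuat_imK (v : E3) : (toQuat v).imK = v 2 := rfl

@[simp] theorem toQuat_zero : toQuat 0 = 0 := by ext <;> simp
theorem toQuat_add (v w : E3) : toQuat (v + w) = toQuat v + toQuat w := by ext <;> simp
theorem toQuat_sub (v w : E3) : toQuat (v - w) = toQuat v - toQuat w := by ext <;> simp
theorem toQuat_neg (v : E3) : toQuat (-v) = -toQuat v := by ext <;> simp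
theorem toQuat_smul (t : ℝ) (v : E3) : toQuat (t • v) = t • toQuat v := by ext <;> simp

@[simp] theorem imVec_toQuat (v : E3) : imVec (toQuat v) = v := by
  ext i; fin_cases i <;> rfl

theorem toQuat_injective : Function.Injective toQuat :=
  Function.LeftInverse.injective imVec_toQuat

theorem toQuat_eq_zero {v : E3} : toQuat v = 0 ↔ v = 0 := by
  rw [← toQuat_zero, toQuat_injective.eq_iff]

theorem normSq_toQuat (v : E3) : Quaternion.normSq (toQuat v) = ‖v‖ ^ 2 := by
  rw [Quaternion.normSq_def', norm_sq_eq]; simp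

theorem toQuat_inv (v : E3) : (toQuat v)⁻¹ = -toQuat (vinv v) := by
  rw [Quaternion.inv_def, normSq_toQuat, vinv, toQuat_smul, ← smul_neg]
  congr 1
  ext <;> simp

theorem toQuat_mul (v w : E3) :
    toQuat v * toQuat w = toQuat (cross v w) - (inner ℝ v w : ℝ) • (1 : ℍ[ℝ]) := by
  rw [inner_eq]
  ext <;> simp [cross, cross_apply] <;> ring

theorem imVec_smul (t : ℝ) (q : ℍ[ℝ]) : imVec (t • q) = t • imVec q := by
  ext i; fin_cases i <;> simp [imVec]

theorem norm_sq_eq_re_sq_add (q : ℍ[ℝ]) : ‖q‖ ^ 2 = q.re ^ 2 + ‖imVec q‖ ^ 2 := by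
  rw [pow_two ‖q‖, ← Quaternion.normSq_eq_norm_mul_self, Quaternion.normSq_def', norm_sq_eq]
  simp [imVec]; ring

/-! ### The principal square root -/

theorem imVec_mul_self (r : ℍ[ℝ]) : imVec (r * r) = (2 * r.re) • imVec r := by
  ext i; fin_cases i <;> simp [imVec] <;> ring

theorem re_mul_self (r : ℍ[ℝ]) : (r * r).re = r.re ^ 2 - ‖imVec r‖ ^ 2 := by
  rw [norm_sq_eq]; simp [imVec]; ring

/-- The principal square root is the root with positive real part. -/
theorem qsqrt_mul_self {r : ℍ[ℝ]} (hr : 0 < r.re) : qsqrt (r * r) = r := by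
  have hr0 : r ≠ 0 := by rintro rfl; simp at hr
  have hn : 0 < ‖r‖ := norm_pos_iff.2 hr0
  have hnsq := norm_sq_eq_re_sq_add r
  set c := r.re / ‖r‖ with hc
  have hc0 : 0 ≤ c := by positivity
  have hc1 : c ≤ 1 := by
    rw [hc, div_le_one hn]
    exact abs_le_of_sq_le_sq' (by nlinarith [sq_nonneg ‖imVec r‖]) hn.le |>.2
  have hangle : polarAngle (r * r) = 2 * Real.arccos c := by
    have hcos : (r * r).re / ‖r * r‖ = Real.cos (2 * Real.arccos c) := by
      rw [Real.cos_two_mul, Real.cos_arccos (by linarith) hc1, re_mul_self, norm_mul, hc,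
        div_pow, ← pow_two]
      field_simp
      linarith
    rw [polarAngle, hcos, Real.arccos_cos]
    · have := Real.arccos_nonneg c; linarith
    · have := Real.arccos_le_pi_div_two.2 hc0; linarith
  have hsin : Real.sin (Real.arccos c) = ‖imVec r‖ / ‖r‖ := by
    rw [Real.sin_arccos, Real.sqrt_eq_iff_mul_self_eq (by nlinarith) (by positivity), hc]
    field_simp
    linarith
  have him : ‖imVec (r * r)‖⁻¹ • imVec (r * r) = ‖imVec r‖⁻¹ • imVec r := by
    rw [imVec_mul_self, norm_smul, Real.norm_of_nonneg (by positivity), smul_smul]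
    congr 1
    field_simp
  rw [qsqrt, hangle, him, norm_mul, Real.sqrt_mul_self hn.le,
    mul_div_cancel_left₀ _ two_ne_zero, Real.cos_arccos (by linarith) hc1, hsin,
    mul_div_cancel₀ _ hn.ne', mul_div_cancel₀ _ hn.ne', ← toQuat_smul, smul_smul]
  have : (‖imVec r‖ * ‖imVec r‖⁻¹) • imVec r = imVec r := by
    rcases eq_or_ne (imVec r) 0 with h | h
    · simp [h]
    · rw [mul_inv_cancel₀ (norm_ne_zero_iff.2 h), one_smul]
  rw [this]
  ext <;> simp [imVec]

/-! ### Cross-ratios and the insertion rule -/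

/-- Covariance of the cross-ratio under the inversions `x ↦ p - x⁻¹`. -/
theorem cr_sub_inv {a b c d : ℍ[ℝ]} (p : ℍ[ℝ]) (ha : a ≠ 0) (hb : b ≠ 0) (hc : c ≠ 0)
    (hd : d ≠ 0) :
    cr (p - a⁻¹) (p - b⁻¹) (p - c⁻¹) (p - d⁻¹) = a⁻¹ * cr a b c d * a := by
  have h : ∀ x y : ℍ[ℝ], x ≠ 0 → y ≠ 0 → p - x⁻¹ - (p - y⁻¹) = x⁻¹ * (x - y) * y⁻¹ := by
    intro x y hx hy
    rw [mul_sub, sub_mul, inv_mul_cancel₀ hx, mul_assoc, mul_inv_cancel₀ hy]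
    simp
  have h' : ∀ x y : ℍ[ℝ], x ≠ 0 → y ≠ 0 → p - x⁻¹ - (p - y⁻¹) = y⁻¹ * (x - y) * x⁻¹ := by
    intro x y hx hy
    rw [mul_sub, sub_mul, inv_mul_cancel₀ hy, mul_assoc, mul_inv_cancel₀ hx]
    simp
  rw [cr, h a b ha hb, h' b c hb hc, h c d hc hd, h' d a hd ha, cr]
  simp only [mul_inv_rev, inv_inv, mul_assoc, inv_mul_cancel_left₀ hb, mul_inv_cancel_left₀ hc,
    inv_mul_cancel_left₀ hd]

theorem cr_add_left (t a b c d : ℍ[ℝ]) : cr (t + a) (t + b) (t + c) (t + d) = cr a b c d := by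
  simp [cr]

/-- The insertion rule solves `cr(c, a, b, p)² = cr(c, a, b, d)`; the branch of the root is the
one for which `cr(c, a, b, p)` has negative real part. -/
theorem insertPoint_of_cr {a b c d p r : ℍ[ℝ]}
    (hne : a ≠ b ∧ a ≠ c ∧ a ≠ d ∧ b ≠ c ∧ b ≠ d ∧ c ≠ d) (hpc : p ≠ c) (hp : p.re = 0)
    (hr : cr c a b p = -r) (hrr : cr c a b d = r * r) (hpos : 0 < r.re) :
    InsertPointDefined a b c d ∧ insertPoint a b c d = p := by
  obtain ⟨hab, hac, had, hbc, hbd, hcd⟩ := id hne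
  have hw : insertCoeff a b c d = (b - p) * (p - c)⁻¹ := by
    have hr' : r = -cr c a b p := by rw [hr, neg_neg]
    rw [insertCoeff, hrr, qsqrt_mul_self hpos, hr', cr, ← neg_sub b a, inv_neg]
    have h1 : b - a ≠ 0 := sub_ne_zero.2 hab.symm
    have h2 : c - a ≠ 0 := sub_ne_zero.2 hac.symm
    simp only [mul_neg, neg_mul, neg_neg, mul_assoc, inv_mul_cancel_left₀ h2,
      mul_inv_cancel_left₀ h1]
  have hpc' : p - c ≠ 0 := sub_ne_zero.2 hpc
  have hw1 : insertCoeff a b c d + 1 = (b - c) * (p - c)⁻¹ := by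
    rw [hw, ← sub_add_sub_cancel b p c, add_mul, mul_inv_cancel₀ hpc']
  have hw0 : insertCoeff a b c d + 1 ≠ 0 := by
    rw [hw1]; exact mul_ne_zero (sub_ne_zero.2 hbc) (inv_ne_zero hpc')
  have hwp : insertCoeff a b c d * c + b = (insertCoeff a b c d + 1) * p := by
    have : insertCoeff a b c d * (p - c) = b - p := by
      rw [hw, mul_assoc, inv_mul_cancel₀ hpc', mul_one]
    rw [mul_sub] at this
    rw [add_mul, one_mul, ← sub_eq_zero]
    rw [← sub_eq_zero] at this
    rw [← neg_eq_zero, ← this]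
    abel
  have hins : insertPoint a b c d = p := by
    rw [insertPoint, hwp, inv_mul_cancel_left₀ hw0]
  refine ⟨⟨hne, ?_, hw0, hins ▸ hp⟩, hins⟩
  rw [hrr, imVec_mul_self, re_mul_self]
  rintro ⟨h1, h2⟩
  rcases smul_eq_zero.1 h1 with h | h
  · linarith
  · rw [h, norm_zero] at h2
    nlinarith

/-! ### The inserted points after inversion at `p_{bc}` -/

theorem norm_vinv (v : E3) : ‖vinv v‖ = ‖v‖⁻¹ := by
  rcases eq_or_ne v 0 with rfl | h
  · simp [vinv]
  · have := norm_ne_zero_iff.2 h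
    rw [vinv, norm_smul, norm_inv, norm_pow, norm_norm]
    field_simp

theorem vinv_vinv (v : E3) : vinv (vinv v) = v := by
  rcases eq_or_ne v 0 with rfl | h
  · simp [vinv]
  · have := norm_ne_zero_iff.2 h
    rw [vinv, norm_vinv, vinv, smul_smul]
    rw [show ((‖v‖⁻¹ ^ 2)⁻¹ * (‖v‖ ^ 2)⁻¹ : ℝ) = 1 by field_simp, one_smul]

theorem vinv_injective : Function.Injective vinv :=
  Function.LeftInverse.injective vinv_vinv

theorem toQuat_add_vinv (p v : E3) : toQuat (p + vinv v) = toQuat p - (toQuat v)⁻¹ := by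
  rw [toQuat_add, toQuat_inv, sub_neg_eq_add]

theorem toQuat_add_vinv_ne (p : E3) {v w : E3} (h : v ≠ w) :
    toQuat (p + vinv v) ≠ toQuat (p + vinv w) := fun h' =>
  h (vinv_injective (add_left_cancel (toQuat_injective h')))

theorem re_mul_comm (q r : ℍ[ℝ]) : (q * r).re = (r * q).re := by
  simp; ring

theorem re_conj {c : ℍ[ℝ]} (hc : c ≠ 0) (r : ℍ[ℝ]) : (c⁻¹ * r * c).re = r.re := by
  rw [re_mul_comm, mul_inv_cancel_left₀ hc]

/-- The case of `cr_sub_inv` in which the fourth point is at infinity after the inversion. -/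
theorem cr_sub_inv_infty {a b c : ℍ[ℝ]} (p : ℍ[ℝ]) (ha : a ≠ 0) (hb : b ≠ 0) (hc : c ≠ 0) :
    cr (p - a⁻¹) (p - b⁻¹) (p - c⁻¹) p = -(a⁻¹ * ((a - b) * (b - c)⁻¹) * a) := by
  have h : p - a⁻¹ - (p - b⁻¹) = a⁻¹ * (a - b) * b⁻¹ := by
    rw [mul_sub, sub_mul, inv_mul_cancel₀ ha, mul_assoc, mul_inv_cancel₀ hb]
    simp
  have h' : p - b⁻¹ - (p - c⁻¹) = c⁻¹ * (b - c) * b⁻¹ := by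
    rw [mul_sub, sub_mul, inv_mul_cancel₀ hc, mul_assoc, mul_inv_cancel₀ hb]
    simp
  rw [cr, h, h', show p - c⁻¹ - p = -c⁻¹ by abel, show p - (p - a⁻¹) = a⁻¹ by abel]
  simp only [mul_inv_rev, inv_inv, mul_assoc, inv_mul_cancel_left₀ hb, mul_neg, neg_mul,
    mul_inv_cancel_left₀ hc]

/-- The criterion `insertPoint_of_cr` in the coordinates obtained by inversion at `p`. -/
theorem insertPoint_add_vinv (p : E3) {A B C D Z : E3} {r : ℍ[ℝ]} (hA : A ≠ 0) (hB : B ≠ 0)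
    (hC : C ≠ 0) (hD : D ≠ 0) (hZ : Z ≠ 0)
    (hne : A ≠ B ∧ A ≠ C ∧ A ≠ D ∧ B ≠ C ∧ B ≠ D ∧ C ≠ D) (hZC : Z ≠ C)
    (hr : cr (toQuat C) (toQuat A) (toQuat B) (toQuat Z) = -r)
    (hrr : cr (toQuat C) (toQuat A) (toQuat B) (toQuat D) = r * r) (hpos : 0 < r.re) :
    InsertPointDefined (toQuat (p + vinv A)) (toQuat (p + vinv B)) (toQuat (p + vinv C))
      (toQuat (p + vinv D)) ∧
    insertPoint (toQuat (p + vinv A)) (toQuat (p + vinv B)) (toQuat (p + vinv C))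
      (toQuat (p + vinv D)) = toQuat (p + vinv Z) := by
  have hC' := mt toQuat_eq_zero.1 hC
  obtain ⟨h1, h2, h3, h4, h5, h6⟩ := hne
  refine insertPoint_of_cr (r := (toQuat C)⁻¹ * r * toQuat C)
    ⟨toQuat_add_vinv_ne p h1, toQuat_add_vinv_ne p h2, toQuat_add_vinv_ne p h3,
      toQuat_add_vinv_ne p h4, toQuat_add_vinv_ne p h5, toQuat_add_vinv_ne p h6⟩
    (toQuat_add_vinv_ne p hZC) rfl ?_ ?_ ?_
  · simp only [toQuat_add_vinv]
    rw [cr_sub_inv _ hC' (mt toQuat_eq_zero.1 hA) (mt toQuat_eq_zero.1 hB)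
      (mt toQuat_eq_zero.1 hZ), hr, mul_neg, neg_mul]
  · simp only [toQuat_add_vinv]
    rw [cr_sub_inv _ hC' (mt toQuat_eq_zero.1 hA) (mt toQuat_eq_zero.1 hB)
      (mt toQuat_eq_zero.1 hD), hrr]
    simp only [mul_assoc, mul_inv_cancel_left₀ hC']
  · rwa [re_conj hC']

theorem toQuat_ne_zero {v : E3} (h : v ≠ 0) : toQuat v ≠ 0 := mt toQuat_eq_zero.1 h

theorem re_toQuat_mul (v w : E3) : (toQuat v * toQuat w).re = -inner ℝ v w := by
  rw [toQuat_mul]; simp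

/-- Positivity of the real part of the root occurring in `p_{bc}` and `p_{da}`. -/
theorem re_mul_inv_pos {α β : E3} (h : ‖α‖ < ‖β‖) :
    0 < ((toQuat α + toQuat β) * (toQuat β - toQuat α)⁻¹).re := by
  rw [← toQuat_add, ← toQuat_sub, toQuat_inv, mul_neg, Quaternion.re_neg, re_toQuat_mul, neg_neg,
    vinv, inner_smul_right]
  have h0 : β - α ≠ 0 := by
    rw [sub_ne_zero]; rintro rfl; exact lt_irrefl _ h
  have : inner ℝ (α + β) (β - α) = ‖β‖ ^ 2 - ‖α‖ ^ 2 := by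
    rw [inner_add_left, inner_sub_right, inner_sub_right, real_inner_self_eq_norm_sq,
      real_inner_self_eq_norm_sq, real_inner_comm]
    ring
  rw [this]
  have := norm_pos_iff.2 h0
  have : 0 < ‖β‖ ^ 2 - ‖α‖ ^ 2 := by nlinarith [norm_nonneg α]
  positivity

/-- The points `x ± α`, `x ± β` are the vertices of a parallelogram with `0 < ‖α‖ < ‖β‖`, and none
of them is the origin. They stand for the images of `a, d` and `b, c` under inversion at
`p_{bc}`. -/
structure Parallelogram (x α β : E3) : Prop where
  lt : ‖α‖ < ‖β‖
  ne_zero : α ≠ 0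
  addα : x + α ≠ 0
  subα : x - α ≠ 0
  addβ : x + β ≠ 0
  subβ : x - β ≠ 0

namespace Parallelogram

variable {x α β : E3}

theorem β_ne_zero (h : Parallelogram x α β) : β ≠ 0 :=
  norm_pos_iff.1 ((norm_nonneg α).trans_lt h.lt)

theorem α_ne (h : Parallelogram x α β) : α ≠ β := by
  rintro rfl; exact lt_irrefl _ h.lt

theorem α_ne_neg (h : Parallelogram x α β) : α ≠ -β := by
  rintro rfl; have := h.lt; rw [norm_neg] at this; exact lt_irrefl _ this

theorem ne_neg_self {v : E3} (h : v ≠ 0) : v ≠ -v := by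
  intro h'
  have h2 : (2 : ℝ) • v = 0 := by
    rw [two_smul]
    nth_rewrite 1 [h']
    exact neg_add_cancel v
  exact h ((smul_eq_zero.1 h2).resolve_left two_ne_zero)

/-- The inversion centre itself is the point `p_{bc} = f(a, b, c, d)`. -/
theorem insertPoint_bc (h : Parallelogram x α β) (p : E3) :
    InsertPointDefined (toQuat (p + vinv (x + α))) (toQuat (p + vinv (x + β)))
      (toQuat (p + vinv (x - β))) (toQuat (p + vinv (x - α))) ∧
    insertPoint (toQuat (p + vinv (x + α))) (toQuat (p + vinv (x + β)))
      (toQuat (p + vinv (x - β))) (toQuat (p + vinv (x - α))) = toQuat p := by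
  have hs : toQuat β - toQuat α ≠ 0 := by
    rw [← toQuat_sub]; exact toQuat_ne_zero (sub_ne_zero.2 h.α_ne.symm)
  have hC := toQuat_ne_zero h.subβ
  have hA := toQuat_ne_zero h.addα
  have hB := toQuat_ne_zero h.addβ
  have hD := toQuat_ne_zero h.subα
  set r := (toQuat α + toQuat β) * (toQuat β - toQuat α)⁻¹ with hr
  refine insertPoint_of_cr (r := (toQuat (x - β))⁻¹ * r * toQuat (x - β))
    ⟨toQuat_add_vinv_ne p ?_, toQuat_add_vinv_ne p ?_, toQuat_add_vinv_ne p ?_,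
      toQuat_add_vinv_ne p ?_, toQuat_add_vinv_ne p ?_, toQuat_add_vinv_ne p ?_⟩
    ?_ rfl ?_ ?_ ?_
  · exact fun h' => h.α_ne (add_left_cancel h')
  · rw [sub_eq_add_neg]; exact fun h' => h.α_ne_neg (add_left_cancel h')
  · rw [sub_eq_add_neg]; exact fun h' => ne_neg_self h.ne_zero (add_left_cancel h')
  · rw [sub_eq_add_neg]; exact fun h' => ne_neg_self h.β_ne_zero (add_left_cancel h')
  · rw [sub_eq_add_neg]; exact fun h' => h.α_ne_neg (neg_eq_iff_eq_neg.1 (add_left_cancel h').symm)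
  · exact fun h' => h.α_ne (sub_right_injective h').symm
  · rw [toQuat_add_vinv]
    intro h'
    exact inv_ne_zero hC (by simpa using h'.symm)
  · rw [toQuat_add_vinv, toQuat_add_vinv, toQuat_add_vinv, cr_sub_inv_infty _ hC hA hB, hr]
    have e1 : toQuat (x - β) - toQuat (x + α) = -(toQuat α + toQuat β) := by
      rw [toQuat_add, toQuat_sub]; abel
    have e2 : toQuat (x + α) - toQuat (x + β) = -(toQuat β - toQuat α) := by
      rw [toQuat_add, toQuat_add]; abel
    rw [e1, e2, inv_neg, neg_mul_neg]
  · simp only [toQuat_add_vinv]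
    rw [cr_sub_inv _ hC hA hB hD]
    have e1 : cr (toQuat (x - β)) (toQuat (x + α)) (toQuat (x + β)) (toQuat (x - α)) = r * r := by
      simp only [toQuat_add, toQuat_neg, sub_eq_add_neg, cr_add_left]
      rw [cr, hr, show -toQuat β - toQuat α = -(toQuat α + toQuat β) by abel,
        show toQuat α - toQuat β = -(toQuat β - toQuat α) by abel,
        show toQuat β - -toQuat α = toQuat α + toQuat β by abel,
        show -toQuat α - -toQuat β = toQuat β - toQuat α by abel, inv_neg, neg_mul_neg]
      simp only [mul_assoc]
    rw [e1]
    simp only [mul_assoc, mul_inv_cancel_left₀ hC]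
  · rw [re_conj hC]
    exact re_mul_inv_pos h.lt

/-- The point `p_{da} = f(c, d, a, b)` is the image of the centre of the parallelogram. -/
theorem insertPoint_da (h : Parallelogram x α β) (hx : x ≠ 0) (p : E3) :
    InsertPointDefined (toQuat (p + vinv (x - β))) (toQuat (p + vinv (x - α)))
      (toQuat (p + vinv (x + α))) (toQuat (p + vinv (x + β))) ∧
    insertPoint (toQuat (p + vinv (x - β))) (toQuat (p + vinv (x - α)))
      (toQuat (p + vinv (x + α))) (toQuat (p + vinv (x + β))) = toQuat (p + vinv x) := by
  have hα := toQuat_ne_zero h.ne_zero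
  refine insertPoint_add_vinv (r := (toQuat α + toQuat β) * (toQuat β - toQuat α)⁻¹) p h.subβ
    h.subα h.addα h.addβ hx ⟨?_, ?_, ?_, ?_, ?_, ?_⟩ ?_ ?_ ?_ (re_mul_inv_pos h.lt)
  · exact fun h' => h.α_ne (sub_right_injective h').symm
  · rw [sub_eq_add_neg]; exact fun h' => h.α_ne_neg (add_left_cancel h').symm
  · rw [sub_eq_add_neg]; exact fun h' => ne_neg_self h.β_ne_zero (add_left_cancel h').symm
  · rw [sub_eq_add_neg]; exact fun h' => ne_neg_self h.ne_zero (add_left_cancel h').symm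
  · rw [sub_eq_add_neg]; exact fun h' => h.α_ne_neg (neg_eq_iff_eq_neg.1 (add_left_cancel h'))
  · exact fun h' => h.α_ne (add_left_cancel h')
  · exact fun h' => h.ne_zero (left_eq_add.1 h')
  · rw [show toQuat x = toQuat x + 0 by simp]
    simp only [toQuat_add, toQuat_neg, sub_eq_add_neg, cr_add_left]
    rw [cr, zero_sub, sub_zero, mul_assoc _ (-toQuat α), mul_inv_cancel₀ (neg_ne_zero.2 hα),
      mul_one, show toQuat α - -toQuat β = toQuat α + toQuat β by abel,
      show -toQuat β - -toQuat α = -(toQuat β + -toQuat α) by abel, inv_neg, mul_neg]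
  · simp only [toQuat_add, toQuat_neg, sub_eq_add_neg, cr_add_left]
    rw [cr, show toQuat α - -toQuat β = toQuat α + toQuat β by abel,
      show -toQuat β - -toQuat α = -(toQuat β + -toQuat α) by abel, inv_neg,
      show -toQuat α - toQuat β = -(toQuat α + toQuat β) by abel,
      show toQuat β - toQuat α = toQuat β + -toQuat α by abel]
    simp only [mul_assoc, mul_neg, neg_mul, neg_neg]

end Parallelogram

/-- The bisector of `α` and `β` of length `√(‖α‖ ‖β‖)`. -/
def bisector (α β : E3) : E3 :=
  (√(2 * (‖α‖ * ‖β‖ + inner ℝ α β)))⁻¹ • (‖β‖ • α + ‖α‖ • β)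

theorem bisector_comm (α β : E3) : bisector α β = bisector β α := by
  rw [bisector, bisector, real_inner_comm, mul_comm ‖α‖ ‖β‖, add_comm (‖β‖ • α)]

theorem bisector_neg_neg (α β : E3) : bisector (-α) (-β) = -bisector α β := by
  simp only [bisector, norm_neg, inner_neg_neg, smul_neg, ← neg_add]

section bisector

variable {α β : E3}

theorem norm_bisector_sq (h : 0 < ‖α‖ * ‖β‖ + inner ℝ α β) :
    ‖bisector α β‖ ^ 2 = ‖α‖ * ‖β‖ := by
  rw [bisector, norm_smul, mul_pow, norm_inv, Real.norm_of_nonneg (Real.sqrt_nonneg _), inv_pow,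
    Real.sq_sqrt (by linarith), norm_add_sq_real, norm_smul, norm_smul, inner_smul_left,
    inner_smul_right]
  simp only [norm_norm, RCLike.conj_to_real]
  field_simp
  ring

theorem inner_bisector (h : 0 < ‖α‖ * ‖β‖ + inner ℝ α β) :
    (2 * inner ℝ (bisector α β) α) • bisector α β = ‖α‖ • (‖β‖ • α + ‖α‖ • β) := by
  have hs := Real.sq_sqrt (show 0 ≤ 2 * (‖α‖ * ‖β‖ + inner ℝ α β) by linarith)
  have hs0 := (Real.sqrt_pos.2 (show 0 < 2 * (‖α‖ * ‖β‖ + inner ℝ α β) by linarith)).ne'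
  rw [bisector, inner_smul_left, inner_add_left, inner_smul_left, inner_smul_left, smul_smul,
    real_inner_self_eq_norm_sq, real_inner_comm α β]
  simp only [RCLike.conj_to_real]
  congr 1
  field_simp
  rw [hs]
  ring

theorem toQuat_mul_mul_self (v w : E3) :
    toQuat v * toQuat w * toQuat v = toQuat (‖v‖ ^ 2 • w - (2 * inner ℝ v w) • v) := by
  rw [norm_sq_eq, inner_eq]
  ext <;> simp <;> ring

/-- The half-turn about the bisector exchanges the directions of `α` and `β`; in the complex plane
spanned by `α` and `β` this says that `m² = α β`. -/
theorem bisector_mul_inv_mul (hα : α ≠ 0) (h : 0 < ‖α‖ * ‖β‖ + inner ℝ α β) :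
    toQuat (bisector α β) * (toQuat α)⁻¹ * toQuat (bisector α β) = toQuat β := by
  rw [toQuat_inv, mul_neg, neg_mul, vinv, toQuat_smul, mul_smul_comm, smul_mul_assoc,
    toQuat_mul_mul_self, inner_bisector h, norm_bisector_sq h, ← toQuat_smul, ← toQuat_neg]
  congr 1
  have := norm_ne_zero_iff.2 hα
  rw [smul_add, smul_smul, smul_smul, sub_add_eq_sub_sub, sub_self, zero_sub, smul_neg, neg_neg,
    smul_smul, ← pow_two, inv_mul_cancel₀ (pow_ne_zero 2 this), one_smul]

theorem inner_bisector_pos (hα : α ≠ 0) (hβ : β ≠ 0) (h : 0 < ‖α‖ * ‖β‖ + inner ℝ α β) :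
    0 < inner ℝ (bisector α β) (vinv α + vinv β) := by
  have ha := norm_pos_iff.2 hα
  have hb := norm_pos_iff.2 hβ
  rw [bisector, inner_smul_left, vinv, vinv]
  simp only [RCLike.conj_to_real]
  refine mul_pos (inv_pos.2 (Real.sqrt_pos.2 (by linarith))) ?_
  simp only [inner_add_left, inner_add_right, inner_smul_left, inner_smul_right,
    real_inner_self_eq_norm_sq, real_inner_comm α β, RCLike.conj_to_real]
  have : (‖α‖ ^ 2)⁻¹ * (‖β‖ * ‖α‖ ^ 2 + ‖α‖ * inner ℝ α β) +
      (‖β‖ ^ 2)⁻¹ * (‖β‖ * inner ℝ α β + ‖α‖ * ‖β‖ ^ 2) =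
      (‖α‖ + ‖β‖) / (‖α‖ * ‖β‖) * (‖α‖ * ‖β‖ + inner ℝ α β) := by
    field_simp
    ring
  rw [this]
  positivity

theorem neg_sub_self_inv (a : ℍ[ℝ]) : (-a - a)⁻¹ = -((2⁻¹ : ℝ) • a⁻¹) := by
  have : -a - a = -((2 : ℝ) • a) := by rw [two_smul]; abel
  rw [this, inv_neg, smul_inv₀]

/-- After inversion, the points `p_{ab}` and `p_{cd}` are the translates of the centre of the
parallelogram by the two bisectors. -/
theorem insertPoint_bisector {x : E3} (hn : ‖α‖ ≠ ‖β‖) (h : 0 < ‖α‖ * ‖β‖ + inner ℝ α β)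
    (hα : α ≠ 0) (hβ : β ≠ 0) (h1 : x + α ≠ 0) (h2 : x - α ≠ 0) (h3 : x + β ≠ 0)
    (h4 : x - β ≠ 0) (hm : x + bisector α β ≠ 0) (p : E3) :
    InsertPointDefined (toQuat (p + vinv (x - α))) (toQuat (p + vinv (x + α)))
      (toQuat (p + vinv (x + β))) (toQuat (p + vinv (x - β))) ∧
    insertPoint (toQuat (p + vinv (x - α))) (toQuat (p + vinv (x + α)))
      (toQuat (p + vinv (x + β))) (toQuat (p + vinv (x - β))) =
        toQuat (p + vinv (x + bisector α β)) := by
  have hαβ : α ≠ β := by rintro rfl; exact hn rfl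
  have hαβ' : α ≠ -β := by rintro rfl; exact hn (norm_neg _)
  have hmβ : bisector α β ≠ β := by
    intro h'
    have := norm_bisector_sq h
    rw [h', pow_two] at this
    exact hn (mul_right_cancel₀ (norm_ne_zero_iff.2 hβ) this).symm
  have qα := toQuat_ne_zero hα
  have qβ := toQuat_ne_zero hβ
  have e1 := bisector_mul_inv_mul hα h
  have e2 := bisector_mul_inv_mul hβ (β := α) (by rwa [real_inner_comm, mul_comm])
  rw [bisector_comm] at e2
  have hpos : 0 < (toQuat (bisector α β) * ((toQuat α)⁻¹ + (toQuat β)⁻¹)).re := by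
    rw [toQuat_inv, toQuat_inv, ← neg_add, ← toQuat_add, mul_neg, Quaternion.re_neg,
      re_toQuat_mul, neg_neg]
    exact inner_bisector_pos hα hβ h
  have qmβ : toQuat (bisector α β) - toQuat β ≠ 0 := by
    rw [← toQuat_sub]; exact toQuat_ne_zero (sub_ne_zero.2 hmβ)
  set m := toQuat (bisector α β) with hmdef
  refine insertPoint_add_vinv
    (r := (2⁻¹ : ℝ) • ((toQuat β + toQuat α) * (toQuat α)⁻¹ * m * (toQuat β)⁻¹)) p h2 h1 h3 h4 hm
    ⟨?_, ?_, ?_, ?_, ?_, ?_⟩ ?_ ?_ ?_ ?_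
  · rw [sub_eq_add_neg]
    exact fun h' => Parallelogram.ne_neg_self hα (add_left_cancel h').symm
  · rw [sub_eq_add_neg]
    exact fun h' => hαβ' (neg_eq_iff_eq_neg.1 (add_left_cancel h'))
  · exact fun h' => hαβ (sub_right_injective h')
  · exact fun h' => hαβ (add_left_cancel h')
  · rw [sub_eq_add_neg]; exact fun h' => hαβ' (add_left_cancel h')
  · rw [sub_eq_add_neg]; exact fun h' => Parallelogram.ne_neg_self hβ (add_left_cancel h')
  · exact fun h' => hmβ (add_left_cancel h')
  · simp only [toQuat_add, toQuat_neg, sub_eq_add_neg, cr_add_left, ← hmdef]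
    have e3 : (toQuat α - m) * (m - toQuat β)⁻¹ = m * (toQuat β)⁻¹ := by
      rw [← div_eq_mul_inv, div_eq_iff qmβ, mul_sub, e2, mul_assoc, inv_mul_cancel₀ qβ, mul_one]
    rw [cr, mul_assoc, e3, neg_sub_self_inv, sub_neg_eq_add, mul_neg, neg_mul, mul_smul_comm,
      smul_mul_assoc, mul_assoc _ m]
  · simp only [toQuat_add, toQuat_neg, sub_eq_add_neg, cr_add_left]
    have e3 : m * ((toQuat β)⁻¹ * ((toQuat β + toQuat α) * ((toQuat α)⁻¹ * m))) =
        toQuat α + toQuat β := by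
      rw [add_mul, mul_inv_cancel_left₀ qα, mul_add, inv_mul_cancel_left₀ qβ, mul_add,
        ← mul_assoc, e1, ← mul_assoc, e2, add_comm]
    have e4 : m * ((toQuat β)⁻¹ * ((toQuat β + toQuat α) * ((toQuat α)⁻¹ * (m * (toQuat β)⁻¹)))) =
        (toQuat α + toQuat β) * (toQuat β)⁻¹ := by
      rw [← e3]; simp only [mul_assoc]
    rw [cr, neg_sub_self_inv, neg_sub_self_inv, sub_neg_eq_add, sub_neg_eq_add]
    simp only [smul_mul_assoc, mul_smul_comm, mul_neg, neg_mul, mul_assoc, smul_neg]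
    rw [neg_neg, e4]
  · rw [Quaternion.re_smul]
    refine smul_pos (by norm_num) ?_
    rw [mul_assoc _ m, re_mul_comm]
    have : m * (toQuat β)⁻¹ * ((toQuat β + toQuat α) * (toQuat α)⁻¹) =
        m * ((toQuat α)⁻¹ + (toQuat β)⁻¹) := by
      rw [mul_assoc, add_mul, mul_inv_cancel₀ qα, mul_add, mul_one, inv_mul_cancel_left₀ qβ]
    rwa [this]

end bisector

/-! ### The circle through a point and three inverted collinear points -/

/-- The foot of the perpendicular from the origin to the line through `x` in direction `m`. -/
def foot (x m : E3) : E3 := x - (inner ℝ x m / ‖m‖ ^ 2) • m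

theorem inner_foot_right (x : E3) {m : E3} (hm : m ≠ 0) : inner ℝ m (foot x m) = 0 := by
  have := norm_ne_zero_iff.2 hm
  rw [foot, inner_sub_right, inner_smul_right, real_inner_self_eq_norm_sq, real_inner_comm]
  field_simp
  ring

theorem inner_foot_left (x : E3) {m : E3} (hm : m ≠ 0) : inner ℝ x (foot x m) = ‖foot x m‖ ^ 2 := by
  have h : x = foot x m + (inner ℝ x m / ‖m‖ ^ 2) • m := by rw [foot]; abel
  nth_rewrite 1 [h]
  rw [inner_add_left, inner_smul_left, inner_foot_right x hm, mul_zero, add_zero,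
    real_inner_self_eq_norm_sq]

theorem foot_smul (x m : E3) {t : ℝ} (ht : t ≠ 0) : foot x (t • m) = foot x m := by
  rw [foot, foot, inner_smul_right, norm_smul, smul_smul, mul_pow, Real.norm_eq_abs, sq_abs]
  congr 2
  rcases eq_or_ne ‖m‖ 0 with h | h
  · simp [h]
  · field_simp

theorem foot_smul_left (x m : E3) (t : ℝ) : foot (t • x) m = t • foot x m := by
  rw [foot, foot, inner_smul_left, smul_sub, smul_smul, mul_div_assoc]
  rfl

theorem linearIndependent_of_foot {x m : E3} (hm : m ≠ 0) (hF : foot x m ≠ 0) :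
    LinearIndependent ℝ ![x, m] := by
  rw [LinearIndependent.pair_iff]
  intro s t h
  have h1 : inner ℝ (s • x + t • m) (foot x m) = 0 := by rw [h, inner_zero_left]
  rw [inner_add_left, inner_smul_left, inner_smul_left, inner_foot_left x hm,
    inner_foot_right x hm, mul_zero, add_zero] at h1
  have hs : s = 0 := (mul_eq_zero.1 h1).resolve_right (pow_ne_zero 2 (norm_ne_zero_iff.2 hF))
  refine ⟨hs, ?_⟩
  rw [hs, zero_smul, zero_add] at h
  exact (smul_eq_zero.1 h).resolve_right hm

theorem add_smul_ne_zero_of_foot {x m : E3} (hm : m ≠ 0) (hF : foot x m ≠ 0) (t : ℝ) :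
    x + t • m ≠ 0 := by
  intro h
  have := LinearIndependent.pair_iff.1 (linearIndependent_of_foot hm hF) 1 t (by rwa [one_smul])
  exact one_ne_zero this.1

/-- A point `vinv z` is as far from `y` as the origin exactly when `z` lies on the polar plane
`⟨z, y⟩ = 1 / 2`. -/
theorem norm_vinv_sub_eq_iff {z : E3} (hz : z ≠ 0) (y : E3) :
    ‖vinv z - y‖ = ‖y‖ ↔ inner ℝ z y = 1 / 2 := by
  have hz' := norm_ne_zero_iff.2 hz
  rw [← sq_eq_sq₀ (norm_nonneg _) (norm_nonneg _), norm_sub_sq_real, norm_vinv, vinv,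
    inner_smul_left]
  simp only [RCLike.conj_to_real]
  constructor
  · intro h
    field_simp at h
    linarith
  · intro h
    rw [h]
    field_simp
    ring

/-- The circle obtained by inverting the line through `x` in direction `m`. It passes through the
centre `p` of the inversion, and its antipode there is the image of the foot point. -/
theorem existsUnique_circle (p : E3) {x m : E3} (hm : m ≠ 0) (hF : foot x m ≠ 0) :
    ∃ C : SpaceCircle, (p + vinv (x + m) ∈ C.points ∧ p ∈ C.points ∧ p + vinv (x - m) ∈ C.points ∧
        p + vinv x ∈ C.points) ∧
      C.center = p + (2 * ‖foot x m‖ ^ 2)⁻¹ • foot x m ∧ C.radius = (2 * ‖foot x m‖)⁻¹ ∧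
      ∀ C' : SpaceCircle, (p + vinv (x + m) ∈ C'.points ∧ p ∈ C'.points ∧
        p + vinv (x - m) ∈ C'.points ∧ p + vinv x ∈ C'.points) → C' = C := by
  have hFn := norm_pos_iff.2 hF
  have hx : x ≠ 0 := by simpa using add_smul_ne_zero_of_foot hm hF 0
  have hxp : x + m ≠ 0 := by simpa using add_smul_ne_zero_of_foot hm hF 1
  have hxm : x - m ≠ 0 := by simpa [sub_eq_add_neg] using add_smul_ne_zero_of_foot hm hF (-1)
  have hli := linearIndependent_of_foot hm hF
  set V : Submodule ℝ E3 := Submodule.span ℝ {x, m} with hV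
  have hVrank : Module.finrank ℝ V = 2 := by
    have := finrank_span_eq_card hli
    rwa [Matrix.range_cons, Matrix.range_cons, Matrix.range_empty, Set.union_empty,
      Set.singleton_union, Fintype.card_fin] at this
  have hxV : x ∈ V := Submodule.subset_span (by simp)
  have hmV : m ∈ V := Submodule.subset_span (by simp)
  have hFV : foot x m ∈ V := V.sub_mem hxV (V.smul_mem _ hmV)
  set y := (2 * ‖foot x m‖ ^ 2)⁻¹ • foot x m with hy
  have hyn : ‖y‖ = (2 * ‖foot x m‖)⁻¹ := by
    rw [hy, norm_smul, Real.norm_of_nonneg (by positivity)]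
    field_simp
  have hxy : inner ℝ x y = 1 / 2 := by
    rw [hy, inner_smul_right, inner_foot_left x hm]
    field_simp
  have hmy : inner ℝ m y = 0 := by rw [hy, inner_smul_right, inner_foot_right x hm, mul_zero]
  have hmem : ∀ z ∈ V, z ≠ 0 → inner ℝ z y = 1 / 2 →
      p + vinv z ∈ AffineSubspace.mk' p V ∧ dist (p + vinv z) (p + y) = (2 * ‖foot x m‖)⁻¹ := by
    intro z hz hz0 hzy
    refine ⟨?_, ?_⟩
    · rw [AffineSubspace.mem_mk', vsub_eq_sub, add_sub_cancel_left]
      exact V.smul_mem _ hz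
    · rw [dist_add_left, dist_eq_norm, (norm_vinv_sub_eq_iff hz0 y).2 hzy, hyn]
  let C : SpaceCircle :=
    { plane := AffineSubspace.mk' p V
      finrank_plane := by rw [AffineSubspace.direction_mk', hVrank]
      center := p + y
      center_mem := by
        rw [AffineSubspace.mem_mk', vsub_eq_sub, add_sub_cancel_left]
        exact V.smul_mem _ hFV
      radius := (2 * ‖foot x m‖)⁻¹
      radius_pos := by positivity }
  refine ⟨C, ⟨hmem _ (V.add_mem hxV hmV) hxp (by rw [inner_add_left, hxy, hmy, add_zero]),
    ⟨AffineSubspace.self_mem_mk' _ _, ?_⟩,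
    hmem _ (V.sub_mem hxV hmV) hxm (by rw [inner_sub_left, hxy, hmy, sub_zero]),
    hmem _ hxV hx hxy⟩, rfl, rfl, ?_⟩
  · change dist p (p + y) = _
    rw [dist_self_add_right, hyn]
  rintro ⟨P, hP, c, hc, R, hR⟩ ⟨⟨h1, h1'⟩, ⟨h2, h2'⟩, ⟨h3, h3'⟩, ⟨h4, h4'⟩⟩
  dsimp only at h1 h1' h2 h2' h3 h3' h4 h4'
  have hdir : ∀ z : E3, z ≠ 0 → p + vinv z ∈ P → z ∈ P.direction := by
    intro z hz hzP
    have := AffineSubspace.vsub_mem_direction hzP h2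
    rw [vsub_eq_sub, add_sub_cancel_left] at this
    have h := P.direction.smul_mem (‖z‖ ^ 2) this
    rwa [vinv, smul_smul, mul_inv_cancel₀ (pow_ne_zero 2 (norm_ne_zero_iff.2 hz)), one_smul] at h
  have hxP := hdir x hx h4
  have hmP : m ∈ P.direction := by
    have := P.direction.sub_mem (hdir _ hxp h1) hxP
    rwa [add_sub_cancel_left] at this
  have hVP : V = P.direction := by
    refine Submodule.eq_of_le_of_finrank_eq (Submodule.span_le.2 ?_) (by rw [hVrank, hP])
    rintro z (rfl | rfl)
    · exact hxP
    · exact hmP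
  have hplane : P = AffineSubspace.mk' p V := by
    rw [hVP, AffineSubspace.mk'_eq h2]
  have hcn : ‖c - p‖ = R := by rw [← h2', dist_comm, dist_eq_norm]
  have hpolar : ∀ z : E3, z ≠ 0 → dist (p + vinv z) c = R → inner ℝ z (c - p) = 1 / 2 := by
    intro z hz h
    rw [← norm_vinv_sub_eq_iff hz, hcn, ← h, dist_eq_norm]
    congr 1
    abel
  have k1 := hpolar x hx h4'
  have k2 : inner ℝ m (c - p) = 0 := by
    have := hpolar _ hxp h1'
    rw [inner_add_left, k1] at this
    linarith
  have hcV : c - p ∈ V := by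
    rw [hVP]; exact AffineSubspace.vsub_mem_direction hc h2
  have hcy : c - p = y := by
    rw [← sub_eq_zero, ← inner_self_eq_zero (𝕜 := ℝ)]
    have hd : c - p - y ∈ V := V.sub_mem hcV (V.smul_mem _ hFV)
    obtain ⟨s, t, hst⟩ := Submodule.mem_span_pair.1 hd
    nth_rewrite 1 [← hst]
    rw [inner_add_left, inner_smul_left, inner_smul_left, inner_sub_right x (c - p) y,
      inner_sub_right m (c - p) y, k1, k2,
      hxy, hmy]
    simp
  have hc' : c = p + y := by rw [← hcy]; abel
  have hR' : R = (2 * ‖foot x m‖)⁻¹ := by rw [← hcn, hcy, hyn]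
  subst hplane hc' hR'
  rfl

theorem bisector_ne_zero {α β : E3} (hα : α ≠ 0) (hβ : β ≠ 0)
    (h : 0 < ‖α‖ * ‖β‖ + inner ℝ α β) : bisector α β ≠ 0 := by
  intro h0
  have := norm_bisector_sq h
  rw [h0, norm_zero, zero_pow two_ne_zero] at this
  exact (mul_pos (norm_pos_iff.2 hα) (norm_pos_iff.2 hβ)).ne this

/-- The discrete curvature circle in the coordinates obtained by inversion at `p_{bc}`. -/
theorem Parallelogram.curvatureCircle {x α β : E3} (h : Parallelogram x α β)
    (hpos : 0 < ‖α‖ * ‖β‖ + inner ℝ α β) (hF : foot x (bisector α β) ≠ 0) {γ : ℤ → E3} {i : ℤ}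
    {p : E3} (ha : γ (i - 1) = p + vinv (x + α)) (hb : γ i = p + vinv (x + β))
    (hc : γ (i + 1) = p + vinv (x - β)) (hd : γ (i + 2) = p + vinv (x - α)) :
    CurvatureCircleDefined γ i ∧ discreteCurvature γ i = 2 * ‖foot x (bisector α β)‖ ∧
      discreteNormal γ i = ‖foot x (bisector α β)‖⁻¹ • foot x (bisector α β) := by
  set F := foot x (bisector α β) with hFdef
  have hm := bisector_ne_zero h.ne_zero h.β_ne_zero hpos
  have hx : x ≠ 0 := by simpa using add_smul_ne_zero_of_foot hm hF 0
  have hxp : x + bisector α β ≠ 0 := by simpa using add_smul_ne_zero_of_foot hm hF 1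
  have hxm : x - bisector α β ≠ 0 := by
    simpa [sub_eq_add_neg] using add_smul_ne_zero_of_foot hm hF (-1)
  have hFn := norm_pos_iff.2 hF
  have hbc := h.insertPoint_bc p
  have hda := h.insertPoint_da hx p
  have hab := insertPoint_bisector h.lt.ne hpos h.ne_zero h.β_ne_zero h.addα h.subα h.addβ h.subβ
    hxp p
  -- Exchanging `(α, β)` with `(-β, -α)` turns `f(d, a, b, c)` into `f(b, c, d, a)`.
  have hcd := insertPoint_bisector (α := -β) (β := -α) (x := x) (by simpa using h.lt.ne')
    (by rwa [norm_neg, norm_neg, inner_neg_neg, real_inner_comm, mul_comm])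
    (neg_ne_zero.2 h.β_ne_zero) (neg_ne_zero.2 h.ne_zero) (by simpa [sub_eq_add_neg] using h.subβ)
    (by simpa using h.addβ)
    (by simpa [sub_eq_add_neg] using h.subα) (by simpa using h.addα)
    (by rwa [bisector_neg_neg, bisector_comm, ← sub_eq_add_neg]) p
  rw [bisector_neg_neg, bisector_comm] at hcd
  simp only [sub_neg_eq_add, ← sub_eq_add_neg] at hcd
  have va : vertex γ (i - 1) = toQuat (p + vinv (x + α)) := by rw [vertex, ha]
  have vb : vertex γ i = toQuat (p + vinv (x + β)) := by rw [vertex, hb]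
  have vc : vertex γ (i + 1) = toQuat (p + vinv (x - β)) := by rw [vertex, hc]
  have vd : vertex γ (i + 2) = toQuat (p + vinv (x - α)) := by rw [vertex, hd]
  have pbc : imVec (pBC γ i) = p := by rw [pBC, va, vb, vc, vd, hbc.2, imVec_toQuat]
  obtain ⟨C, hC, hcenter, hradius, huniq⟩ := existsUnique_circle p hm hF
  have hiff : ∀ C' : SpaceCircle, IsCurvatureCircle γ i C' ↔
      (p + vinv (x + bisector α β) ∈ C'.points ∧ p ∈ C'.points ∧
        p + vinv (x - bisector α β) ∈ C'.points ∧ p + vinv x ∈ C'.points) := by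
    intro C'
    rw [IsCurvatureCircle, pbc, pAB, pCD, pDA, va, vb, vc, vd, hab.2, hcd.2, hda.2, imVec_toQuat,
      imVec_toQuat, imVec_toQuat]
  have hex : ∃ C', IsCurvatureCircle γ i C' := ⟨C, (hiff C).2 hC⟩
  have hchoose : hex.choose = C := huniq _ ((hiff _).1 hex.choose_spec)
  refine ⟨⟨?_, ?_, ?_, ?_, C, (hiff C).2 hC, fun C' hC' => huniq C' ((hiff C').1 hC')⟩, ?_, ?_⟩
  · rw [va, vb, vc, vd]; exact hab.1
  · rw [va, vb, vc, vd]; exact hbc.1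
  · rw [va, vb, vc, vd]; exact hcd.1
  · rw [va, vb, vc, vd]; exact hda.1
  · rw [discreteCurvature, dif_pos hex, hchoose, hradius, inv_inv]
  · rw [discreteNormal, dif_pos hex, hchoose, hcenter, pbc, add_sub_cancel_left, norm_smul,
      Real.norm_of_nonneg (by positivity), smul_smul]
    congr 1
    field_simp
    exact div_self hFn.ne'

/-- Since the curvature is `2 ‖F‖` and the normal `F / ‖F‖`, the quotient of normal and curvature is
rational in the foot point `F`. -/
theorem Parallelogram.discreteTorsion_eq {x α β : E3} (h : Parallelogram x α β)
    (hpos : 0 < ‖α‖ * ‖β‖ + inner ℝ α β) (hF : foot x (bisector α β) ≠ 0) {γ : ℤ → E3} {i : ℤ}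
    {p : E3} (ha : γ (i - 1) = p + vinv (x + α)) (hb : γ i = p + vinv (x + β))
    (hc : γ (i + 1) = p + vinv (x - β)) (hd : γ (i + 2) = p + vinv (x - α)) :
    discreteTorsion γ i = -(9 * inner ℝ
      (imVec (cr (vertex γ (i - 1)) (vertex γ i) (vertex γ (i + 1)) (vertex γ (i + 2))))
      (foot x (bisector α β))) /
      (4 * ‖foot x (bisector α β)‖ ^ 2 * ‖γ i - γ (i + 1)‖ ^ 2) := by
  obtain ⟨-, h1, h2⟩ := h.curvatureCircle hpos hF ha hb hc hd
  rw [discreteTorsion, h1, h2, inner_smul_right]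
  have := norm_ne_zero_iff.2 hF
  rcases eq_or_ne ‖γ i - γ (i + 1)‖ 0 with h0 | h0
  · simp [h0]
  · field_simp
    ring

/-! ### Four points placed symmetrically up to second order -/

/-- The common denominator `‖P + ε v‖² ‖P - ε v‖²` of `invMid` and `invHalf`, with `η = ε²`. -/
def invDen (P v : E3) (η : ℝ) : ℝ := (‖P‖ ^ 2 + η * ‖v‖ ^ 2) ^ 2 - 4 * η * inner ℝ P v ^ 2

/-- The midpoint of the images of `-ε (P + ε v)` and `ε (P - ε v)` under inversion, as a function
of `η = ε²`. -/
def invMid (P v : E3) (η : ℝ) : E3 :=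
  (invDen P v η)⁻¹ • ((2 * inner ℝ P v) • P - (‖P‖ ^ 2 + η * ‖v‖ ^ 2) • v)

/-- Half the image of `ε (P - ε v)` minus half the image of `-ε (P + ε v)` under inversion,
multiplied by `ε`, as a function of `η = ε²`. -/
def invHalf (P v : E3) (η : ℝ) : E3 :=
  (invDen P v η)⁻¹ • ((‖P‖ ^ 2 + η * ‖v‖ ^ 2) • P - (2 * η * inner ℝ P v) • v)

theorem vinv_smul (t : ℝ) (v : E3) : vinv (t • v) = t⁻¹ • vinv v := by
  rw [vinv, vinv, norm_smul, smul_smul, smul_smul, mul_pow, Real.norm_eq_abs, sq_abs]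
  congr 1
  rcases eq_or_ne t 0 with rfl | h
  · simp
  · rcases eq_or_ne ‖v‖ 0 with h' | h'
    · simp [h']
    · field_simp

theorem norm_add_smul_sq (P v : E3) (ε : ℝ) :
    ‖P + ε • v‖ ^ 2 = ‖P‖ ^ 2 + ε ^ 2 * ‖v‖ ^ 2 + 2 * ε * inner ℝ P v := by
  rw [norm_add_sq_real, inner_smul_right, norm_smul, mul_pow, Real.norm_eq_abs, sq_abs]
  ring

theorem invDen_eq (P v : E3) (ε : ℝ) :
    invDen P v (ε ^ 2) = ‖P + ε • v‖ ^ 2 * ‖P + (-ε) • v‖ ^ 2 := by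
  rw [norm_add_smul_sq, norm_add_smul_sq, invDen]
  ring

theorem vinv_neg_smul_add {P v : E3} {ε : ℝ} (hε : ε ≠ 0) (h : P + ε • v ≠ 0)
    (h' : P + (-ε) • v ≠ 0) :
    vinv ((-ε) • (P + ε • v)) = invMid P v (ε ^ 2) + (-ε⁻¹) • invHalf P v (ε ^ 2) := by
  have hn := norm_ne_zero_iff.2 h
  have hn' := norm_ne_zero_iff.2 h'
  have e : vinv (P + ε • v) = invHalf P v (ε ^ 2) - ε • invMid P v (ε ^ 2) := by
    have : (‖P + ε • v‖ ^ 2)⁻¹ = (invDen P v (ε ^ 2))⁻¹ * ‖P + (-ε) • v‖ ^ 2 := by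
      rw [invDen_eq]; field_simp
    rw [vinv, this, norm_add_smul_sq P v (-ε), invHalf, invMid]
    module
  rw [vinv_smul, e, inv_neg, smul_sub, smul_smul, neg_mul, inv_mul_cancel₀ hε]
  module

theorem norm_smul_mul_add_inner (t : ℝ) (α β : E3) :
    ‖t • α‖ * ‖t • β‖ + inner ℝ (t • α) (t • β) = t ^ 2 * (‖α‖ * ‖β‖ + inner ℝ α β) := by
  rw [norm_smul, norm_smul, inner_smul_left, inner_smul_right, Real.norm_eq_abs,
    RCLike.conj_to_real]
  linear_combination (‖α‖ * ‖β‖) * sq_abs t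

theorem bisector_smul {t : ℝ} (ht : t ≠ 0) (α β : E3) :
    bisector (t • α) (t • β) = t • bisector α β := by
  have h : 2 * (‖t • α‖ * ‖t • β‖ + inner ℝ (t • α) (t • β)) =
      |t| ^ 2 * (2 * (‖α‖ * ‖β‖ + inner ℝ α β)) := by
    rw [norm_smul_mul_add_inner, sq_abs]
    ring
  have ht' := abs_ne_zero.2 ht
  rw [bisector, h, Real.sqrt_mul (sq_nonneg _), Real.sqrt_sq (abs_nonneg _), norm_smul, norm_smul,
    Real.norm_eq_abs, bisector, mul_inv]
  simp only [smul_add, smul_smul]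
  congr 2 <;> field_simp

/-- The foot point that determines the curvature circle of the configuration
`-ε P, ε P, ε² g ∓ 3 ε Q` with `p_{bc} = ε² v`, as a function of `η = ε²`. -/
def circleFoot (P Q g v : E3) (η : ℝ) : E3 :=
  foot (invMid P v η) (‖invHalf P v η‖ • invHalf ((3 : ℝ) • Q) (v - g) η +
    ‖invHalf ((3 : ℝ) • Q) (v - g) η‖ • invHalf P v η)

theorem foot_bisector {α β : E3} (h : 0 < ‖α‖ * ‖β‖ + inner ℝ α β) (x : E3) :
    foot x (bisector α β) = foot x (‖β‖ • α + ‖α‖ • β) :=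
  foot_smul x _ (inv_ne_zero (Real.sqrt_pos.2 (by linarith)).ne')

/-- The conditions under which the points `-ε P, ε P, ε² g ∓ 3 ε Q` have a discrete curvature
circle with `p_{bc} = ε² v`. -/
structure Admissible (P Q g v : E3) (ε : ℝ) : Prop where
  ne_zero : ε ≠ 0
  mid_eq : invMid P v (ε ^ 2) = invMid ((3 : ℝ) • Q) (v - g) (ε ^ 2)
  b_ne : P + ε • v ≠ 0
  c_ne : P + (-ε) • v ≠ 0
  a_ne : (3 : ℝ) • Q + ε • (v - g) ≠ 0
  d_ne : (3 : ℝ) • Q + (-ε) • (v - g) ≠ 0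
  half_ne : invHalf ((3 : ℝ) • Q) (v - g) (ε ^ 2) ≠ 0
  half_lt : ‖invHalf ((3 : ℝ) • Q) (v - g) (ε ^ 2)‖ < ‖invHalf P v (ε ^ 2)‖
  half_pos : 0 < ‖invHalf ((3 : ℝ) • Q) (v - g) (ε ^ 2)‖ * ‖invHalf P v (ε ^ 2)‖ +
    inner ℝ (invHalf ((3 : ℝ) • Q) (v - g) (ε ^ 2)) (invHalf P v (ε ^ 2))
  foot_ne : circleFoot P Q g v (ε ^ 2) ≠ 0

theorem vinv_eq_zero {v : E3} : vinv v = 0 ↔ v = 0 := by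
  rw [← vinv_injective.eq_iff, vinv_vinv, show vinv 0 = 0 by simp [vinv]]

theorem Admissible.curvatureCircle {P Q g v : E3} {ε : ℝ} (h : Admissible P Q g v ε) {γ : ℤ → E3}
    {i : ℤ} {E : E3} (ha : γ (i - 1) = E + ε ^ 2 • g - (3 * ε) • Q) (hb : γ i = E - ε • P)
    (hc : γ (i + 1) = E + ε • P) (hd : γ (i + 2) = E + ε ^ 2 • g + (3 * ε) • Q) :
    CurvatureCircleDefined γ i ∧
    discreteTorsion γ i = -(9 * inner ℝ
      (imVec (cr (vertex γ (i - 1)) (vertex γ i) (vertex γ (i + 1)) (vertex γ (i + 2))))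
      (circleFoot P Q g v (ε ^ 2))) /
      (4 * ‖circleFoot P Q g v (ε ^ 2)‖ ^ 2 * ‖γ i - γ (i + 1)‖ ^ 2) := by
  have hε := h.ne_zero
  have ht : -ε⁻¹ ≠ 0 := neg_ne_zero.2 (inv_ne_zero hε)
  set p := E + ε ^ 2 • v with hp
  set x := invMid P v (ε ^ 2) with hx
  set B := invHalf P v (ε ^ 2) with hB
  set A := invHalf ((3 : ℝ) • Q) (v - g) (ε ^ 2) with hA
  have eb := vinv_neg_smul_add hε h.b_ne h.c_ne
  have ec := vinv_neg_smul_add (neg_ne_zero.2 hε) h.c_ne (by simpa using h.b_ne)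
  have ea := vinv_neg_smul_add hε h.a_ne h.d_ne
  have ed := vinv_neg_smul_add (neg_ne_zero.2 hε) h.d_ne (by simpa using h.a_ne)
  rw [neg_sq] at ec ed
  rw [← hx, ← hB] at eb ec
  rw [← h.mid_eq, ← hx, ← hA] at ea ed
  have hinv : ∀ {y z w : E3} (_ : vinv y = w) (_ : z = p + y), z = p + vinv w := by
    rintro y z w rfl rfl
    rw [vinv_vinv]
  have hne : ∀ {y w : E3} {t : ℝ} (_ : vinv (t • y) = w) (_ : t ≠ 0) (_ : y ≠ 0), w ≠ 0 := by
    rintro y w t rfl ht hy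
    exact mt vinv_eq_zero.1 (smul_ne_zero ht hy)
  have hε' := neg_ne_zero.2 hε
  have hε'' := neg_ne_zero.2 hε'
  have hs : ∀ z : E3, x + -(-ε)⁻¹ • z = x - (-ε⁻¹) • z := by
    intro z; rw [inv_neg]; module
  rw [hs] at ec ed
  have hpar : Parallelogram x ((-ε⁻¹) • A) ((-ε⁻¹) • B) :=
    { lt := by
        rw [norm_smul, norm_smul]
        exact mul_lt_mul_of_pos_left h.half_lt (norm_pos_iff.2 ht)
      ne_zero := smul_ne_zero ht h.half_ne
      addα := hne ea hε' h.a_ne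
      subα := hne ed hε'' h.d_ne
      addβ := hne eb hε' h.b_ne
      subβ := hne ec hε'' h.c_ne }
  have hpos : 0 < ‖(-ε⁻¹) • A‖ * ‖(-ε⁻¹) • B‖ + inner ℝ ((-ε⁻¹) • A) ((-ε⁻¹) • B) := by
    rw [norm_smul_mul_add_inner]
    exact mul_pos (by positivity) h.half_pos
  have hfoot : foot x (bisector ((-ε⁻¹) • A) ((-ε⁻¹) • B)) = circleFoot P Q g v (ε ^ 2) := by
    rw [bisector_smul ht, foot_smul _ _ ht, foot_bisector h.half_pos, circleFoot]
  have ha' := hinv ea (show γ (i - 1) = p + _ by rw [ha, hp]; module)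
  have hb' := hinv eb (show γ i = p + _ by rw [hb, hp]; module)
  have hc' := hinv ec (show γ (i + 1) = p + _ by rw [hc, hp]; module)
  have hd' := hinv ed (show γ (i + 2) = p + _ by rw [hd, hp]; module)
  have hF : foot x (bisector ((-ε⁻¹) • A) ((-ε⁻¹) • B)) ≠ 0 := by rw [hfoot]; exact h.foot_ne
  have k1 := hpar.curvatureCircle hpos hF ha' hb' hc' hd'
  have k2 := hpar.discreteTorsion_eq hpos hF ha' hb' hc' hd'
  rw [hfoot] at k2
  exact ⟨k1.1, k2⟩

/-! ### The imaginary part of the cross-ratio -/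

/-- The part of the imaginary cross-ratio of `-ε P, ε P, ε² g ∓ 3 ε (P + η R)` that is even in
`ε`, up to a scalar factor. -/
def crEven (P R g : E3) (η : ℝ) : E3 :=
  (‖(2 : ℝ) • P + (3 * η) • R‖ ^ 2 + 2 * inner ℝ ((2 : ℝ) • P + (3 * η) • R) P - η * ‖g‖ ^ 2) •
    cross P R + (2 * inner ℝ g P) • cross g (P + η • R)

theorem cross_apply_eq (v w : E3) : cross v w =
    !₂[v 1 * w 2 - v 2 * w 1, v 2 * w 0 - v 0 * w 2, v 0 * w 1 - v 1 * w 0] := by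
  rw [cross, cross_apply]

/-- The numerator of the cross-ratio. Interchanging the outer factors of a product `x y z` of
imaginary quaternions changes it by a real number; hence the part that is odd in `ε` is a multiple
of `P + ε² R`, that is, tangential. -/
theorem inner_imVec_mul (P R g F : E3) (ε : ℝ) :
    inner ℝ (imVec (toQuat (ε • g - ((2 : ℝ) • P + (3 * ε ^ 2) • R)) * toQuat P *
      toQuat (-(ε • g) - ((2 : ℝ) • P + (3 * ε ^ 2) • R)) * toQuat (P + ε ^ 2 • R))) F =
    ε ^ 2 * (inner ℝ (crEven P R g (ε ^ 2)) F +
      ε * (6 * inner ℝ (cross g P) R * inner ℝ (P + ε ^ 2 • R) F)) := by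
  simp only [inner_eq, crEven, norm_sq_eq, cross_apply_eq]
  simp [imVec]
  ring

theorem inner_imVec_cr {P R g E a b c d F : E3} {ε : ℝ} (hε : ε ≠ 0)
    (ha : a = E + ε ^ 2 • g - (3 * ε) • (P + ε ^ 2 • R)) (hb : b = E - ε • P)
    (hc : c = E + ε • P) (hd : d = E + ε ^ 2 • g + (3 * ε) • (P + ε ^ 2 • R)) :
    inner ℝ (imVec (cr (toQuat a) (toQuat b) (toQuat c) (toQuat d))) F =
    -(12 * ‖P‖ ^ 2 * ‖P + ε ^ 2 • R‖ ^ 2)⁻¹ * (ε ^ 2 * (inner ℝ (crEven P R g (ε ^ 2)) F +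
      ε * (6 * inner ℝ (cross g P) R * inner ℝ (P + ε ^ 2 • R) F))) := by
  have hab : a - b = ε • (ε • g - ((2 : ℝ) • P + (3 * ε ^ 2) • R)) := by rw [ha, hb]; module
  have hbc : b - c = (-2 * ε) • P := by rw [hb, hc]; module
  have hcd : c - d = ε • (-(ε • g) - ((2 : ℝ) • P + (3 * ε ^ 2) • R)) := by rw [hc, hd]; module
  have hda : d - a = (6 * ε) • (P + ε ^ 2 • R) := by rw [hd, ha]; module
  rw [← inner_imVec_mul, cr, ← toQuat_sub, ← toQuat_sub, ← toQuat_sub, ← toQuat_sub, hab, hbc, hcd,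
    hda, toQuat_inv, toQuat_inv, vinv_smul, vinv_smul, vinv, vinv]
  simp only [toQuat_smul, smul_mul_assoc, mul_smul_comm, mul_neg, neg_mul, smul_smul]
  rw [smul_neg, neg_neg, smul_smul, imVec_smul, inner_smul_left, ← neg_mul, RCLike.conj_to_real]
  simp only [mul_inv, inv_neg]
  field_simp
  ring

/-! ### Smooth dependence on the data -/

section smooth

variable {X : Type*} [NormedAddCommGroup X] [NormedSpace ℝ X] {P Q R g v : X → E3} {η : X → ℝ}
  {z : X}

theorem contDiffAt_cross (hP : ContDiffAt ℝ 1 P z) (hQ : ContDiffAt ℝ 1 Q z) :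
    ContDiffAt ℝ 1 (fun y => cross (P y) (Q y)) z := by
  have hP' := contDiffAt_euclidean.1 hP
  have hQ' := contDiffAt_euclidean.1 hQ
  rw [contDiffAt_euclidean]
  have h : ∀ i j, ContDiffAt ℝ 1 (fun y => P y i * Q y j - P y j * Q y i) z := fun i j =>
    ((hP' i).mul (hQ' j)).sub ((hP' j).mul (hQ' i))
  intro i
  simp only [cross_apply_eq]
  fin_cases i
  · exact h 1 2
  · exact h 2 0
  · exact h 0 1

theorem contDiffAt_invDen (hP : ContDiffAt ℝ 1 P z) (hv : ContDiffAt ℝ 1 v z)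
    (hη : ContDiffAt ℝ 1 η z) : ContDiffAt ℝ 1 (fun y => invDen (P y) (v y) (η y)) z :=
  (((hP.norm_sq ℝ).add (hη.mul (hv.norm_sq ℝ))).pow 2).sub
    ((contDiffAt_const.mul hη).mul ((hP.inner ℝ hv).pow 2))

theorem contDiffAt_invMid (hP : ContDiffAt ℝ 1 P z) (hv : ContDiffAt ℝ 1 v z)
    (hη : ContDiffAt ℝ 1 η z) (h : invDen (P z) (v z) (η z) ≠ 0) :
    ContDiffAt ℝ 1 (fun y => invMid (P y) (v y) (η y)) z :=
  ((contDiffAt_invDen hP hv hη).inv h).smul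
    (((contDiffAt_const.mul (hP.inner ℝ hv)).smul hP).sub
      (((hP.norm_sq ℝ).add (hη.mul (hv.norm_sq ℝ))).smul hv))

theorem contDiffAt_invHalf (hP : ContDiffAt ℝ 1 P z) (hv : ContDiffAt ℝ 1 v z)
    (hη : ContDiffAt ℝ 1 η z) (h : invDen (P z) (v z) (η z) ≠ 0) :
    ContDiffAt ℝ 1 (fun y => invHalf (P y) (v y) (η y)) z :=
  ((contDiffAt_invDen hP hv hη).inv h).smul
    ((((hP.norm_sq ℝ).add (hη.mul (hv.norm_sq ℝ))).smul hP).sub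
      (((contDiffAt_const.mul hη).mul (hP.inner ℝ hv)).smul hv))

theorem contDiffAt_foot (hP : ContDiffAt ℝ 1 P z) (hQ : ContDiffAt ℝ 1 Q z) (h : Q z ≠ 0) :
    ContDiffAt ℝ 1 (fun y => foot (P y) (Q y)) z :=
  hP.sub (((hP.inner ℝ hQ).div (hQ.norm_sq ℝ) (pow_ne_zero 2 (norm_ne_zero_iff.2 h))).smul hQ)

theorem contDiffAt_crEven (hP : ContDiffAt ℝ 1 P z) (hR : ContDiffAt ℝ 1 R z)
    (hg : ContDiffAt ℝ 1 g z) (hη : ContDiffAt ℝ 1 η z) :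
    ContDiffAt ℝ 1 (fun y => crEven (P y) (R y) (g y) (η y)) z := by
  have hM : ContDiffAt ℝ 1 (fun y => (2 : ℝ) • P y + (3 * η y) • R y) z :=
    (hP.const_smul (2 : ℝ)).add ((contDiffAt_const.mul hη).smul hR)
  exact ((((hM.norm_sq ℝ).add (contDiffAt_const.mul (hM.inner ℝ hP))).sub
    (hη.mul (hg.norm_sq ℝ))).smul (contDiffAt_cross hP hR)).add
    ((contDiffAt_const.mul (hg.inner ℝ hP)).smul (contDiffAt_cross hg (hP.add (hη.smul hR))))

end smooth

/-! ### The limit configuration -/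

section limit

variable {P g v : E3}

theorem invDen_zero (P v : E3) : invDen P v 0 = ‖P‖ ^ 4 := by
  rw [invDen]; ring

theorem invDen_zero_ne (hP : P ≠ 0) (v : E3) : invDen P v 0 ≠ 0 := by
  rw [invDen_zero]; exact pow_ne_zero 4 (norm_ne_zero_iff.2 hP)

theorem invMid_zero (P v : E3) :
    invMid P v 0 = (‖P‖ ^ 4)⁻¹ • ((2 * inner ℝ P v) • P - ‖P‖ ^ 2 • v) := by
  rw [invMid, invDen_zero, zero_mul, add_zero]

theorem invMid_zero_add (P v w : E3) : invMid P (v + w) 0 = invMid P v 0 + invMid P w 0 := by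
  simp only [invMid_zero, inner_add_right]; module

theorem invMid_zero_smul (P v : E3) (t : ℝ) : invMid P (t • v) 0 = t • invMid P v 0 := by
  simp only [invMid_zero, inner_smul_right]; module

theorem invMid_zero_three_smul (P v : E3) :
    invMid ((3 : ℝ) • P) v 0 = (1 / 9 : ℝ) • invMid P v 0 := by
  simp only [invMid_zero, inner_smul_left, norm_smul, RCLike.conj_to_real, mul_pow, mul_inv,
    Real.norm_ofNat]
  module

/-- For `η = 0` the map `v ↦ invMid P v 0` is a multiple of a half-turn, hence injective. -/
theorem invMid_zero_eq_zero (hP : P ≠ 0) (h : invMid P v 0 = 0) : v = 0 := by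
  have hn := norm_ne_zero_iff.2 hP
  rw [invMid_zero, smul_eq_zero] at h
  have h1 := h.resolve_left (inv_ne_zero (pow_ne_zero 4 hn))
  have h2 : inner ℝ P v = 0 := by
    have : inner ℝ P ((2 * inner ℝ P v) • P - ‖P‖ ^ 2 • v) = 0 := by rw [h1, inner_zero_right]
    rw [inner_sub_right, inner_smul_right, inner_smul_right, real_inner_self_eq_norm_sq] at this
    have h3 : ‖P‖ ^ 2 * inner ℝ P v = 0 := by linarith
    exact (mul_eq_zero.1 h3).resolve_left (pow_ne_zero 2 hn)
  rw [h2, mul_zero, zero_smul, zero_sub, neg_eq_zero, smul_eq_zero] at h1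
  exact h1.resolve_left (pow_ne_zero 2 hn)

theorem invHalf_zero (hP : P ≠ 0) (v : E3) : invHalf P v 0 = (‖P‖ ^ 2)⁻¹ • P := by
  have hn := norm_ne_zero_iff.2 hP
  rw [invHalf, invDen_zero, zero_mul, add_zero, mul_zero, zero_mul, zero_smul, sub_zero, smul_smul]
  congr 1
  field_simp

theorem invHalf_zero_three_smul (hP : P ≠ 0) (v : E3) :
    invHalf ((3 : ℝ) • P) v 0 = (3⁻¹ * (‖P‖ ^ 2)⁻¹) • P := by
  rw [invHalf_zero (smul_ne_zero three_ne_zero hP), norm_smul, Real.norm_ofNat, smul_smul]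
  congr 1
  rw [mul_pow, mul_inv]
  ring

theorem foot_add_smul (x : E3) {m : E3} (hm : m ≠ 0) (t : ℝ) : foot (x + t • m) m = foot x m := by
  have hn := norm_ne_zero_iff.2 hm
  rw [foot, foot, inner_add_left, inner_smul_left, real_inner_self_eq_norm_sq,
    RCLike.conj_to_real, add_div, mul_div_assoc, div_self (pow_ne_zero 2 hn)]
  module

/-- In the limit the foot point is a multiple of the component of `g` normal to `P`. -/
theorem circleFoot_zero (hP : P ≠ 0) (g : E3) :
    circleFoot P P g ((-1 / 8 : ℝ) • g) 0 = (8 * ‖P‖ ^ 2)⁻¹ • foot g P := by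
  have hn := norm_pos_iff.2 hP
  have h1 : ∀ a b s t : ℝ, a • s • P + b • t • P = (a * s + b * t) • P := by intros; module
  rw [circleFoot, invHalf_zero hP, invHalf_zero_three_smul hP, h1, foot_smul, invMid_zero,
    foot_smul_left, sub_eq_neg_add, foot_add_smul _ hP, ← neg_smul, smul_smul, foot_smul_left,
    smul_smul]
  · congr 1
    field_simp
  · rw [norm_smul, norm_smul]
    simp only [norm_mul, norm_inv, norm_pow, norm_norm, Real.norm_ofNat]
    positivity

theorem norm_sq_cross (P g : E3) : ‖cross P g‖ ^ 2 = ‖P‖ ^ 2 * ‖g‖ ^ 2 - inner ℝ P g ^ 2 := by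
  simp only [norm_sq_eq, inner_eq, cross_apply_eq]
  simp
  ring

theorem norm_sq_foot (hP : P ≠ 0) (g : E3) : ‖foot g P‖ ^ 2 = ‖cross P g‖ ^ 2 / ‖P‖ ^ 2 := by
  have hn := norm_ne_zero_iff.2 hP
  rw [← inner_foot_left g hP, norm_sq_cross, foot, inner_sub_right, inner_smul_right,
    real_inner_self_eq_norm_sq, real_inner_comm]
  field_simp

theorem foot_ne_zero (h : cross P g ≠ 0) (hP : P ≠ 0) : foot g P ≠ 0 := by
  rw [← norm_ne_zero_iff, ← pow_ne_zero_iff two_ne_zero, norm_sq_foot hP]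
  exact div_ne_zero (pow_ne_zero 2 (norm_ne_zero_iff.2 h)) (pow_ne_zero 2 (norm_ne_zero_iff.2 hP))

theorem inner_crEven_zero (R : E3) (hP : P ≠ 0) (g : E3) :
    inner ℝ (crEven P R g 0) ((8 * ‖P‖ ^ 2)⁻¹ • foot g P) = inner ℝ (cross P R) g := by
  have hn := norm_ne_zero_iff.2 hP
  have h1 : inner ℝ (cross P R) P = 0 := by
    simp only [inner_eq, cross_apply_eq]; simp; ring
  have h2 : inner ℝ (cross g P) P = 0 := by
    simp only [inner_eq, cross_apply_eq]; simp; ring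
  have h3 : inner ℝ (cross g P) g = 0 := by
    simp only [inner_eq, cross_apply_eq]; simp; ring
  rw [crEven, mul_zero, zero_smul, add_zero, add_zero, zero_mul, sub_zero, foot]
  simp only [inner_add_left, inner_smul_left, inner_smul_right, inner_sub_right, h1, h2, h3,
    norm_smul, real_inner_self_eq_norm_sq, RCLike.conj_to_real, Real.norm_ofNat]
  field_simp
  ring

end limit

/-! ### The point `p_{bc}` as an implicit function -/

/-- The data `(P, R, g, η)` of the configuration `-ε P, ε P, ε² g ∓ 3 ε (P + η R)`, `η = ε²`. -/
abbrev Data := E3 × E3 × E3 × ℝ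

/-- The defect of the parallelogram condition on `p_{bc} = ε² v`: the difference of the midpoints of
the images of `b, c` and of `a, d` under inversion at `p_{bc}`. -/
def midDefect (z : Data × E3) : E3 :=
  invMid z.1.1 z.2 z.1.2.2.2 -
    invMid ((3 : ℝ) • (z.1.1 + z.1.2.2.2 • z.1.2.1)) (z.2 - z.1.2.2.1) z.1.2.2.2

/-- `circleFoot` as a function of the data and the coordinate `v` of `p_{bc}`. -/
def dataFoot (z : Data × E3) : E3 :=
  circleFoot z.1.1 (z.1.1 + z.1.2.2.2 • z.1.2.1) z.1.2.2.1 z.2 z.1.2.2.2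

/-- The part of the discrete torsion that is even in `ε`. -/
def torsionEven (z : Data × E3) : ℝ :=
  3 * inner ℝ (crEven z.1.1 z.1.2.1 z.1.2.2.1 z.1.2.2.2) (dataFoot z) /
    (64 * ‖z.1.1‖ ^ 4 * ‖z.1.1 + z.1.2.2.2 • z.1.2.1‖ ^ 2 * ‖dataFoot z‖ ^ 2)

/-- The part of the discrete torsion that is odd in `ε`, divided by `ε`. -/
def torsionOdd (z : Data × E3) : ℝ :=
  18 * (inner ℝ (cross z.1.2.2.1 z.1.1) z.1.2.1 *
    inner ℝ (z.1.1 + z.1.2.2.2 • z.1.2.1) (dataFoot z)) /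
    (64 * ‖z.1.1‖ ^ 4 * ‖z.1.1 + z.1.2.2.2 • z.1.2.1‖ ^ 2 * ‖dataFoot z‖ ^ 2)

theorem left_ne_zero_of_cross {v w : E3} (h : cross v w ≠ 0) : v ≠ 0 := by
  rintro rfl
  apply h
  ext i; fin_cases i <;> simp [cross_apply_eq]

section coordinates

variable {z : Data × E3}

theorem contDiffAt_P : ContDiffAt ℝ 1 (fun z : Data × E3 => z.1.1) z :=
  contDiffAt_fst.fst

theorem contDiffAt_R : ContDiffAt ℝ 1 (fun z : Data × E3 => z.1.2.1) z :=
  contDiffAt_fst.snd.fst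

theorem contDiffAt_g : ContDiffAt ℝ 1 (fun z : Data × E3 => z.1.2.2.1) z :=
  contDiffAt_fst.snd.snd.fst

theorem contDiffAt_η : ContDiffAt ℝ 1 (fun z : Data × E3 => z.1.2.2.2) z :=
  contDiffAt_fst.snd.snd.snd

theorem contDiffAt_v : ContDiffAt ℝ 1 (fun z : Data × E3 => z.2) z :=
  contDiffAt_snd

theorem contDiffAt_Q : ContDiffAt ℝ 1 (fun z : Data × E3 => z.1.1 + z.1.2.2.2 • z.1.2.1) z :=
  contDiffAt_P.add (contDiffAt_η.smul contDiffAt_R)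

theorem contDiffAt_three_Q :
    ContDiffAt ℝ 1 (fun z : Data × E3 => (3 : ℝ) • (z.1.1 + z.1.2.2.2 • z.1.2.1)) z :=
  contDiffAt_Q.const_smul (3 : ℝ)

theorem contDiffAt_v_sub_g : ContDiffAt ℝ 1 (fun z : Data × E3 => z.2 - z.1.2.2.1) z :=
  contDiffAt_v.sub contDiffAt_g

end coordinates

section limit

variable {P : E3}

theorem invDen_three_Q_ne (hP : P ≠ 0) (R v : E3) :
    invDen ((3 : ℝ) • (P + (0 : ℝ) • R)) v 0 ≠ 0 := by
  rw [zero_smul, add_zero]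
  exact invDen_zero_ne (smul_ne_zero three_ne_zero hP) _

theorem contDiffAt_midDefect (hP : P ≠ 0) (R g v : E3) :
    ContDiffAt ℝ 1 midDefect ((P, R, g, 0), v) := by
  have h1 := contDiffAt_invMid (z := (((P, R, g, 0), v) : Data × E3)) contDiffAt_P contDiffAt_v
    contDiffAt_η (invDen_zero_ne hP v)
  have h2 := contDiffAt_invMid (z := (((P, R, g, 0), v) : Data × E3)) contDiffAt_three_Q
    contDiffAt_v_sub_g contDiffAt_η (invDen_three_Q_ne hP R _)
  exact h1.sub h2

theorem contDiffAt_invHalf_b (hP : P ≠ 0) (R g v : E3) :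
    ContDiffAt ℝ 1 (fun z : Data × E3 => invHalf z.1.1 z.2 z.1.2.2.2) ((P, R, g, 0), v) :=
  contDiffAt_invHalf contDiffAt_P contDiffAt_v contDiffAt_η (invDen_zero_ne hP v)

theorem contDiffAt_invHalf_a (hP : P ≠ 0) (R g v : E3) :
    ContDiffAt ℝ 1 (fun z : Data × E3 => invHalf ((3 : ℝ) • (z.1.1 + z.1.2.2.2 • z.1.2.1))
      (z.2 - z.1.2.2.1) z.1.2.2.2) ((P, R, g, 0), v) :=
  contDiffAt_invHalf contDiffAt_three_Q contDiffAt_v_sub_g contDiffAt_η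
    (invDen_three_Q_ne hP R _)

theorem invHalf_a_zero (hP : P ≠ 0) (R g v : E3) : invHalf ((3 : ℝ) • (P + (0 : ℝ) • R)) (v - g) 0 =
    (3⁻¹ * (‖P‖ ^ 2)⁻¹) • P := by
  rw [zero_smul, add_zero, invHalf_zero_three_smul hP]

theorem contDiffAt_dataFoot (hP : P ≠ 0) (R g v : E3) :
    ContDiffAt ℝ 1 dataFoot ((P, R, g, 0), v) := by
  have hn := norm_pos_iff.2 hP
  have ha := contDiffAt_invHalf_a hP R g v
  have hb := contDiffAt_invHalf_b hP R g v
  have ha0 := invHalf_a_zero hP R g v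
  have hb0 := invHalf_zero hP v
  have hc : (0 : ℝ) < 3⁻¹ * (‖P‖ ^ 2)⁻¹ := by positivity
  have hc' : (0 : ℝ) < (‖P‖ ^ 2)⁻¹ := by positivity
  refine contDiffAt_foot
    (contDiffAt_invMid contDiffAt_P contDiffAt_v contDiffAt_η (invDen_zero_ne hP v))
    (((hb.norm ℝ ?_).smul ha).add ((ha.norm ℝ ?_).smul hb)) ?_
  · dsimp only; rw [hb0]; exact smul_ne_zero hc'.ne' hP
  · dsimp only; rw [ha0]; exact smul_ne_zero hc.ne' hP
  · dsimp only
    rw [ha0, hb0, smul_smul, smul_smul, ← add_smul, norm_smul, norm_smul,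
      Real.norm_of_nonneg hc.le, Real.norm_of_nonneg hc'.le]
    exact smul_ne_zero (by positivity) hP

theorem dataFoot_zero (hP : P ≠ 0) (R g : E3) :
    dataFoot ((P, R, g, 0), (-1 / 8 : ℝ) • g) = (8 * ‖P‖ ^ 2)⁻¹ • foot g P := by
  rw [dataFoot]
  dsimp only
  rw [zero_smul, add_zero, circleFoot_zero hP]

end limit

/-- At `ε = 0` the parallelogram condition is linear and nondegenerate in `v`, so it can be solved
for `v` by a differentiable function of the data. -/
theorem exists_implicit_pBC {P : E3} (hP : P ≠ 0) (R g : E3) :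
    ∃ V : Data → E3, DifferentiableAt ℝ V (P, R, g, 0) ∧ V (P, R, g, 0) = (-1 / 8 : ℝ) • g ∧
      ∀ᶠ x in 𝓝 ((P, R, g, 0) : Data), midDefect (x, V x) = 0 := by
  set x₀ : Data := (P, R, g, 0) with hx₀
  set v₀ : E3 := (-1 / 8 : ℝ) • g with hv₀
  have hval : ∀ v, midDefect (x₀, v) = (8 / 9 : ℝ) • invMid P v 0 + (1 / 9 : ℝ) • invMid P g 0 := by
    intro v
    rw [midDefect, hx₀]
    dsimp only
    rw [zero_smul, add_zero, invMid_zero_three_smul,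
      show v - g = v + (-1 : ℝ) • g by module, invMid_zero_add, invMid_zero_smul]
    module
  have h0 : midDefect (x₀, v₀) = 0 := by
    -- `v₀ = -g / 8` is the zero of the affine map `hval`.
    rw [hval, hv₀, invMid_zero_smul]
    module
  have hstrict : HasStrictFDerivAt midDefect (fderiv ℝ midDefect (x₀, v₀)) (x₀, v₀) :=
    (contDiffAt_midDefect hP R g v₀).hasStrictFDerivAt one_ne_zero
  set L := fderiv ℝ midDefect (x₀, v₀) ∘L ContinuousLinearMap.inr ℝ Data E3 with hL
  -- The partial derivative in `v` is read off along lines, on which `midDefect` is affine.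
  have hLw : ∀ w, L w = (8 / 9 : ℝ) • invMid P w 0 := by
    intro w
    have hline : HasDerivAt (fun t : ℝ => ((x₀, v₀ + t • w) : Data × E3)) (0, w) 0 := by
      refine (hasDerivAt_const _ _).prodMk ?_
      simpa using ((hasDerivAt_id (0 : ℝ)).smul_const w).const_add v₀
    have h1 : HasDerivAt (fun t : ℝ => midDefect (x₀, v₀ + t • w)) (L w) 0 := by
      have : HasFDerivAt midDefect (fderiv ℝ midDefect (x₀, v₀)) (x₀, v₀ + (0 : ℝ) • w) := by
        rw [zero_smul, add_zero]
        exact hstrict.hasFDerivAt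
      exact this.comp_hasDerivAt (0 : ℝ) hline
    have h2 : HasDerivAt (fun t : ℝ => midDefect (x₀, v₀ + t • w))
        ((8 / 9 : ℝ) • invMid P w 0) 0 := by
      have e : (fun t : ℝ => midDefect (x₀, v₀ + t • w)) =
          fun t : ℝ => midDefect (x₀, v₀) + t • ((8 / 9 : ℝ) • invMid P w 0) := by
        funext t
        rw [hval, hval, invMid_zero_add P v₀, invMid_zero_smul P w]
        module
      rw [e]
      simpa using ((hasDerivAt_id (0 : ℝ)).smul_const
        ((8 / 9 : ℝ) • invMid P w 0)).const_add (midDefect (x₀, v₀))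
    exact h1.unique h2
  have hinj : Function.Injective (L : E3 →ₗ[ℝ] E3) := by
    rw [← LinearMap.ker_eq_bot, LinearMap.ker_eq_bot']
    intro w hw
    have hw' : L w = 0 := hw
    rw [hLw] at hw'
    exact invMid_zero_eq_zero hP ((smul_eq_zero.1 hw').resolve_left (by norm_num))
  have hinv : L.IsInvertible :=
    ⟨(LinearEquiv.ofInjectiveEndo (L : E3 →ₗ[ℝ] E3) hinj).toContinuousLinearEquiv, by ext w; rfl⟩
  refine ⟨hstrict.implicitFunctionOfProdDomain hinv,
    (hstrict.hasStrictFDerivAt_implicitFunctionOfProdDomain hinv).hasFDerivAt.differentiableAt,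
    ?_, ?_⟩
  · exact (hstrict.eventually_apply_eq_iff_implicitFunctionOfProdDomain hinv).self_of_nhds.1 rfl
  · have := hstrict.eventually_apply_implicitFunctionOfProdDomain hinv
    rwa [h0] at this

theorem torsionDen_ne {P g : E3} (h : cross P g ≠ 0) (R : E3) :
    64 * ‖P‖ ^ 4 * ‖P + (0 : ℝ) • R‖ ^ 2 *
      ‖dataFoot ((P, R, g, 0), (-1 / 8 : ℝ) • g)‖ ^ 2 ≠ 0 := by
  have hP := left_ne_zero_of_cross h
  have hn := norm_pos_iff.2 hP
  have hf := norm_pos_iff.2 (foot_ne_zero h hP)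
  rw [dataFoot_zero hP, zero_smul, add_zero, norm_smul, Real.norm_of_nonneg (by positivity)]
  positivity

theorem contDiffAt_torsionDen {P : E3} (hP : P ≠ 0) (R g v : E3) :
    ContDiffAt ℝ 1 (fun z : Data × E3 => 64 * ‖z.1.1‖ ^ 4 * ‖z.1.1 + z.1.2.2.2 • z.1.2.1‖ ^ 2 *
      ‖dataFoot z‖ ^ 2) ((P, R, g, 0), v) := by
  have h4 : ContDiffAt ℝ 1 (fun z : Data × E3 => ‖z.1.1‖ ^ 4) ((P, R, g, 0), v) :=
    (contDiffAt_P.norm ℝ hP).pow 4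
  exact ((contDiffAt_const.mul h4).mul (contDiffAt_Q.norm_sq ℝ)).mul
    ((contDiffAt_dataFoot hP R g v).norm_sq ℝ)

theorem differentiableAt_torsionEven {P g : E3} (h : cross P g ≠ 0) (R : E3) :
    DifferentiableAt ℝ torsionEven ((P, R, g, 0), (-1 / 8 : ℝ) • g) := by
  have hP := left_ne_zero_of_cross h
  have h1 := (contDiffAt_crEven contDiffAt_P contDiffAt_R contDiffAt_g contDiffAt_η).inner ℝ
    (contDiffAt_dataFoot hP R g ((-1 / 8 : ℝ) • g))
  exact (((contDiffAt_const (c := (3 : ℝ))).mul h1).div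
    (contDiffAt_torsionDen hP R g ((-1 / 8 : ℝ) • g)) (torsionDen_ne h R)).differentiableAt
    one_ne_zero

theorem differentiableAt_torsionOdd {P g : E3} (h : cross P g ≠ 0) (R : E3) :
    DifferentiableAt ℝ torsionOdd ((P, R, g, 0), (-1 / 8 : ℝ) • g) := by
  have hP := left_ne_zero_of_cross h
  have h1 := contDiffAt_Q.inner ℝ (contDiffAt_dataFoot hP R g ((-1 / 8 : ℝ) • g))
  have h2 := (contDiffAt_cross contDiffAt_g contDiffAt_P).inner ℝ
    (contDiffAt_R (z := ((P, R, g, 0), (-1 / 8 : ℝ) • g)))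
  exact (((contDiffAt_const (c := (18 : ℝ))).mul (h2.mul h1)).div
    (contDiffAt_torsionDen hP R g ((-1 / 8 : ℝ) • g)) (torsionDen_ne h R)).differentiableAt
    one_ne_zero

theorem torsionEven_zero {P g : E3} (h : cross P g ≠ 0) (R : E3) :
    torsionEven ((P, R, g, 0), (-1 / 8 : ℝ) • g) = 3 * inner ℝ (cross P R) g / ‖cross P g‖ ^ 2 := by
  have hP := left_ne_zero_of_cross h
  have hn := norm_pos_iff.2 hP
  have hn' := norm_pos_iff.2 h
  rw [torsionEven, dataFoot_zero hP]
  dsimp only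
  rw [inner_crEven_zero R hP, norm_smul, mul_pow, norm_sq_foot hP, zero_smul, add_zero,
    Real.norm_of_nonneg (by positivity)]
  field_simp
  norm_num

/-- In the limit the foot point is orthogonal to the tangent `P`. -/
theorem torsionOdd_zero {P : E3} (hP : P ≠ 0) (R g : E3) :
    torsionOdd ((P, R, g, 0), (-1 / 8 : ℝ) • g) = 0 := by
  rw [torsionOdd, dataFoot_zero hP]
  dsimp only
  rw [zero_smul, add_zero, inner_smul_right, inner_foot_right g hP]
  simp

/-! ### Existence of the circle and expansion of the torsion for small `ε` -/

/-- All conditions in `Admissible` other than the parallelogram condition are open, and they hold in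
the limit, where the two half-diagonals are `P / (3 ‖P‖²)` and `P / ‖P‖²`. -/
theorem eventually_admissible {P R g : E3} (h : cross P g ≠ 0) {V : Data → E3}
    (hV : ContinuousAt V (P, R, g, 0)) (hV0 : V (P, R, g, 0) = (-1 / 8 : ℝ) • g)
    (hV1 : ∀ᶠ x in 𝓝 ((P, R, g, 0) : Data), midDefect (x, V x) = 0) {X : ℝ → Data}
    (hX : Filter.Tendsto X (𝓝[≠] 0) (𝓝 (P, R, g, 0))) (hη : ∀ ε, (X ε).2.2.2 = ε ^ 2) :
    ∀ᶠ ε in 𝓝[≠] (0 : ℝ), Admissible (X ε).1 ((X ε).1 + ε ^ 2 • (X ε).2.1) (X ε).2.2.1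
      (V (X ε)) ε := by
  have hP := left_ne_zero_of_cross h
  have hn := norm_pos_iff.2 hP
  set v₀ : E3 := (-1 / 8 : ℝ) • g with hv₀
  have hVX : Filter.Tendsto (fun ε => V (X ε)) (𝓝[≠] 0) (𝓝 v₀) := hV0 ▸ hV.tendsto.comp hX
  have hZ : Filter.Tendsto (fun ε => ((X ε, V (X ε)) : Data × E3)) (𝓝[≠] 0)
      (𝓝 ((P, R, g, 0), v₀)) := hX.prodMk_nhds hVX
  have hid : Filter.Tendsto (fun ε : ℝ => ε) (𝓝[≠] 0) (𝓝 0) := nhdsWithin_le_nhds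
  have hidn : Filter.Tendsto (fun ε : ℝ => -ε) (𝓝[≠] 0) (𝓝 0) := by simpa using hid.neg
  have tP := (contDiffAt_P (z := ((P, R, g, 0), v₀))).continuousAt.tendsto.comp hZ
  have tQ := (contDiffAt_three_Q (z := ((P, R, g, 0), v₀))).continuousAt.tendsto.comp hZ
  have tvg := (contDiffAt_v_sub_g (z := ((P, R, g, 0), v₀))).continuousAt.tendsto.comp hZ
  have tA := (contDiffAt_invHalf_a hP R g v₀).continuousAt.tendsto.comp hZ
  have tB := (contDiffAt_invHalf_b hP R g v₀).continuousAt.tendsto.comp hZ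
  have tF := (contDiffAt_dataFoot hP R g v₀).continuousAt.tendsto.comp hZ
  have hA0 := invHalf_a_zero hP R g v₀
  have hB0 := invHalf_zero hP v₀
  have hc : (0 : ℝ) < 3⁻¹ * (‖P‖ ^ 2)⁻¹ := by positivity
  have hc' : (0 : ℝ) < (‖P‖ ^ 2)⁻¹ := by positivity
  have hA0n : ‖(3⁻¹ * (‖P‖ ^ 2)⁻¹) • P‖ = 3⁻¹ * (‖P‖ ^ 2)⁻¹ * ‖P‖ := by
    rw [norm_smul, Real.norm_of_nonneg hc.le]
  have hB0n : ‖(‖P‖ ^ 2)⁻¹ • P‖ = (‖P‖ ^ 2)⁻¹ * ‖P‖ := by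
    rw [norm_smul, Real.norm_of_nonneg hc'.le]
  have h3P : (3 : ℝ) • (P + (0 : ℝ) • R) ≠ 0 := by
    rw [zero_smul, add_zero]; exact smul_ne_zero three_ne_zero hP
  have tb := tP.add (hid.smul hVX)
  have tc := tP.add (hidn.smul hVX)
  have ta := tQ.add (hid.smul tvg)
  have td := tQ.add (hidn.smul tvg)
  dsimp only [Function.comp_def] at tP tQ tvg tA tB tF tb tc ta td
  rw [hA0] at tA
  rw [hB0] at tB
  rw [dataFoot_zero hP] at tF
  rw [zero_smul, add_zero] at tb tc
  rw [zero_smul ℝ (v₀ - g), add_zero] at ta td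
  filter_upwards [self_mem_nhdsWithin, hX.eventually hV1, tb.eventually_ne hP,
    tc.eventually_ne hP, ta.eventually_ne h3P, td.eventually_ne h3P,
    tA.eventually_ne (smul_ne_zero hc.ne' hP),
    tA.norm.eventually_lt tB.norm (by
      rw [hA0n, hB0n, mul_assoc]
      have : 0 < (‖P‖ ^ 2)⁻¹ * ‖P‖ := by positivity
      linarith),
    ((tA.norm.mul tB.norm).add (tA.inner tB)).eventually_const_lt (u := 0) (by
      rw [inner_smul_left, inner_smul_right, real_inner_self_eq_norm_sq, RCLike.conj_to_real]
      positivity),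
    tF.eventually_ne (smul_ne_zero (by positivity) (foot_ne_zero h hP))]
    with ε h1 h2 h3 h4 h5 h6 h7 h8 h9 h10
  rw [midDefect, sub_eq_zero] at h2
  rw [dataFoot] at h10
  dsimp only at h2 h10
  rw [hη] at h2 h5 h6 h7 h8 h9 h10
  exact ⟨h1, h2, h3, h4, h5, h6, h7, h8, h9, h10⟩

theorem Admissible.discreteTorsion_eq {X : Data} {v : E3} {ε : ℝ} (hη : X.2.2.2 = ε ^ 2)
    (h : Admissible X.1 (X.1 + ε ^ 2 • X.2.1) X.2.2.1 v ε) {γ : ℤ → E3}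
    {i : ℤ} {E : E3} (ha : γ (i - 1) = E + ε ^ 2 • X.2.2.1 - (3 * ε) • (X.1 + ε ^ 2 • X.2.1))
    (hb : γ i = E - ε • X.1) (hc : γ (i + 1) = E + ε • X.1)
    (hd : γ (i + 2) = E + ε ^ 2 • X.2.2.1 + (3 * ε) • (X.1 + ε ^ 2 • X.2.1)) :
    discreteTorsion γ i = torsionEven (X, v) + ε * torsionOdd (X, v) := by
  have hε := h.ne_zero
  rw [(h.curvatureCircle ha hb hc hd).2]
  simp only [vertex]
  rw [inner_imVec_cr hε ha hb hc hd, torsionEven, torsionOdd, dataFoot]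
  dsimp only
  rw [hη, hb, hc, show E - ε • X.1 - (E + ε • X.1) = (-2 * ε) • X.1 by module, norm_smul,
    mul_pow (‖_‖), Real.norm_eq_abs, sq_abs]
  set F := circleFoot X.1 (X.1 + ε ^ 2 • X.2.1) X.2.2.1 v (ε ^ 2)
  rw [mul_inv, mul_inv]
  rcases eq_or_ne ‖X.1‖ 0 with h1 | h1
  · simp [h1]
  rcases eq_or_ne ‖X.1 + ε ^ 2 • X.2.1‖ 0 with h2 | h2
  · simp [h2]
  have h3 : ‖F‖ ≠ 0 := norm_ne_zero_iff.2 h.foot_ne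
  field_simp
  ring

/-! ### Taylor expansion of the sampled curve -/

theorem taylor_five {s : ℝ → E3} (hs : ContDiff ℝ 5 s) (u : ℝ) :
    ∃ r : ℝ → E3, (r =O[𝓝 0] fun h => h ^ 5) ∧ ∀ h, s (u + h) = s u + h • deriv s u +
      (h ^ 2 / 2) • iteratedDeriv 2 s u + (h ^ 3 / 6) • iteratedDeriv 3 s u +
      (h ^ 4 / 24) • iteratedDeriv 4 s u + (h ^ 5 / 120) • iteratedDeriv 5 s u + r h := by
  have h := (taylor_isLittleO_univ (x₀ := u) (n := 5) (f := s) hs).isBigO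
  have ht : Filter.Tendsto (fun h : ℝ => u + h) (𝓝 0) (𝓝 u) := by
    have : Continuous fun h : ℝ => u + h := by fun_prop
    simpa using this.tendsto 0
  refine ⟨_, (h.comp_tendsto ht).congr_right (fun h => by simp), fun h => ?_⟩
  simp only [Function.comp, taylor_within_apply, Finset.sum_range_succ, Finset.sum_range_zero,
    iteratedDerivWithin_univ, add_sub_cancel_left, iteratedDeriv_zero, iteratedDeriv_one]
  simp [Nat.factorial]
  module

/-- The data `(P, R, g, ε²)` of the sampled curve `s (u ± ε)`, `s (u ± 3 ε)`. -/
def sampleData (s : ℝ → E3) (u ε : ℝ) : Data :=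
  ((2 * ε)⁻¹ • (s (u + ε) - s (u + -ε)),
    (ε ^ 2)⁻¹ • ((6 * ε)⁻¹ • (s (u + 3 * ε) - s (u + -3 * ε)) -
      (2 * ε)⁻¹ • (s (u + ε) - s (u + -ε))),
    (ε ^ 2)⁻¹ • ((1 / 2 : ℝ) • (s (u + 3 * ε) + s (u + -3 * ε)) -
      (1 / 2 : ℝ) • (s (u + ε) + s (u + -ε))), ε ^ 2)

/-- The data are even in `ε`, so their deviation from the limit is of second order. -/
theorem sampleData_sub_isBigO {s : ℝ → E3} (hs : ContDiff ℝ 5 s) (u : ℝ) :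
    (fun ε => sampleData s u ε - (deriv s u, (4 / 3 : ℝ) • iteratedDeriv 3 s u,
      (4 : ℝ) • iteratedDeriv 2 s u, 0)) =O[𝓝[≠] (0 : ℝ)] fun ε => ε ^ 2 := by
  obtain ⟨r, hr, hT⟩ := taylor_five hs u
  have hρ : ∀ c : ℝ, (fun ε : ℝ => (ε ^ 3)⁻¹ • r (c * ε)) =O[𝓝[≠] (0 : ℝ)] fun ε => ε ^ 2 := by
    intro c
    have ht : Filter.Tendsto (fun ε : ℝ => c * ε) (𝓝[≠] 0) (𝓝 0) := by
      have : Continuous fun ε : ℝ => c * ε := by fun_prop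
      simpa using (this.tendsto 0).mono_left nhdsWithin_le_nhds
    have h1 : (fun ε : ℝ => r (c * ε)) =O[𝓝[≠] (0 : ℝ)] fun ε => ε ^ 5 := by
      refine (hr.comp_tendsto ht).trans ?_
      simp only [Function.comp_def, mul_pow]
      exact isBigO_const_mul_self _ _ _
    refine ((isBigO_refl (fun ε : ℝ => (ε ^ 3)⁻¹) _).smul h1).trans_eventuallyEq ?_
    filter_upwards [self_mem_nhdsWithin] with ε hε
    have hε : ε ≠ 0 := hε
    rw [smul_eq_mul]
    field_simp
  have hcρ : ∀ (k : ℝ → ℝ) (_ : Continuous k) (c : ℝ),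
      (fun ε : ℝ => k ε • ((ε ^ 3)⁻¹ • r (c * ε))) =O[𝓝[≠] (0 : ℝ)] fun ε => ε ^ 2 := by
    intro k hk c
    have : k =O[𝓝[≠] (0 : ℝ)] fun _ => (1 : ℝ) :=
      ((hk.tendsto 0).mono_left nhdsWithin_le_nhds).isBigO_one ℝ
    simpa using this.smul (hρ c)
  have hw : ∀ (w : ℝ → E3) (_ : Continuous w),
      (fun ε : ℝ => ε ^ 2 • w ε) =O[𝓝[≠] (0 : ℝ)] fun ε => ε ^ 2 := by
    intro w hw
    have : w =O[𝓝[≠] (0 : ℝ)] fun _ => (1 : ℝ) :=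
      ((hw.tendsto 0).mono_left nhdsWithin_le_nhds).isBigO_one ℝ
    simpa using (isBigO_refl (fun ε : ℝ => ε ^ 2) _).smul this
  have hP : (fun ε => (sampleData s u ε).1 - deriv s u) =O[𝓝[≠] (0 : ℝ)] fun ε => ε ^ 2 := by
    refine IsBigO.congr' (((hw (fun ε => (1 / 6 : ℝ) • iteratedDeriv 3 s u +
      (ε ^ 2 / 120) • iteratedDeriv 5 s u) (by fun_prop)).add
      (hcρ (fun ε => ε ^ 2 / 2) (by fun_prop) 1)).sub
      (hcρ (fun ε => ε ^ 2 / 2) (by fun_prop) (-1))) ?_ .rfl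
    filter_upwards [self_mem_nhdsWithin] with ε hε
    have hε : ε ≠ 0 := hε
    dsimp only [sampleData]
    rw [hT ε, hT (-ε), one_mul, neg_one_mul]
    match_scalars <;> field_simp <;> ring
  have hR : (fun ε => (sampleData s u ε).2.1 - (4 / 3 : ℝ) • iteratedDeriv 3 s u)
      =O[𝓝[≠] (0 : ℝ)] fun ε => ε ^ 2 := by
    refine IsBigO.congr' (((((hw (fun ε => (2 / 3 : ℝ) • iteratedDeriv 5 s u) (by fun_prop)).add
      (hcρ (fun _ => 1 / 6) (by fun_prop) 3)).sub (hcρ (fun _ => 1 / 6) (by fun_prop) (-3))).sub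
      (hcρ (fun _ => 1 / 2) (by fun_prop) 1)).add (hcρ (fun _ => 1 / 2) (by fun_prop) (-1))) ?_ .rfl
    filter_upwards [self_mem_nhdsWithin] with ε hε
    have hε : ε ≠ 0 := hε
    dsimp only [sampleData]
    rw [hT ε, hT (-ε), hT (3 * ε), hT (-3 * ε), one_mul, neg_one_mul]
    match_scalars <;> field_simp <;> ring
  have hg : (fun ε => (sampleData s u ε).2.2.1 - (4 : ℝ) • iteratedDeriv 2 s u)
      =O[𝓝[≠] (0 : ℝ)] fun ε => ε ^ 2 := by
    refine IsBigO.congr' (((((hw (fun ε => (10 / 3 : ℝ) • iteratedDeriv 4 s u) (by fun_prop)).add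
      (hcρ (fun ε => ε / 2) (by fun_prop) 3)).add (hcρ (fun ε => ε / 2) (by fun_prop) (-3))).sub
      (hcρ (fun ε => ε / 2) (by fun_prop) 1)).sub (hcρ (fun ε => ε / 2) (by fun_prop) (-1))) ?_ .rfl
    filter_upwards [self_mem_nhdsWithin] with ε hε
    have hε : ε ≠ 0 := hε
    dsimp only [sampleData]
    rw [hT ε, hT (-ε), hT (3 * ε), hT (-3 * ε), one_mul, neg_one_mul]
    match_scalars <;> field_simp <;> ring
  refine hP.prod_left (hR.prod_left (hg.prod_left ?_))
  exact (isBigO_refl (fun ε : ℝ => ε ^ 2) _).congr_left fun ε => by simp [sampleData]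

theorem cross_smul_right (v w : E3) (t : ℝ) : cross v (t • w) = t • cross v w := by
  simp only [cross_apply_eq]
  ext i; fin_cases i <;> simp <;> ring

theorem limit_torsion_eq (s : ℝ → E3) (u : ℝ) :
    3 * inner ℝ (cross (deriv s u) ((4 / 3 : ℝ) • iteratedDeriv 3 s u))
      ((4 : ℝ) • iteratedDeriv 2 s u) /
      ‖cross (deriv s u) ((4 : ℝ) • iteratedDeriv 2 s u)‖ ^ 2 = torsion s u := by
  have h : inner ℝ (cross (deriv s u) (iteratedDeriv 3 s u)) (iteratedDeriv 2 s u) =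
      -inner ℝ (cross (deriv s u) (iteratedDeriv 2 s u)) (iteratedDeriv 3 s u) := by
    simp only [inner_eq, cross_apply_eq]
    simp
    ring
  rw [cross_smul_right, cross_smul_right, inner_smul_left, inner_smul_right, norm_smul, h, torsion,
    Real.norm_ofNat, RCLike.conj_to_real]
  rcases eq_or_ne ‖cross (deriv s u) (iteratedDeriv 2 s u)‖ 0 with h0 | h0
  · simp [h0]
  · field_simp

theorem exists_sample_eq (s : ℝ → E3) (u : ℝ) {ε : ℝ} (hε : ε ≠ 0) :
    ∃ E : E3,
      sample s u ε (0 - 1) = E + ε ^ 2 • (sampleData s u ε).2.2.1 -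
        (3 * ε) • ((sampleData s u ε).1 + ε ^ 2 • (sampleData s u ε).2.1) ∧
      sample s u ε 0 = E - ε • (sampleData s u ε).1 ∧
      sample s u ε (0 + 1) = E + ε • (sampleData s u ε).1 ∧
      sample s u ε (0 + 2) = E + ε ^ 2 • (sampleData s u ε).2.2.1 +
        (3 * ε) • ((sampleData s u ε).1 + ε ^ 2 • (sampleData s u ε).2.1) := by
  refine ⟨(1 / 2 : ℝ) • (s (u + ε) + s (u + -ε)), ?_⟩
  have ea : sample s u ε (0 - 1) = s (u + -3 * ε) := by
    rw [sample]; congr 2; push_cast; ring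
  have eb : sample s u ε 0 = s (u + -ε) := by
    rw [sample]; congr 1; push_cast; ring
  have ec : sample s u ε (0 + 1) = s (u + ε) := by
    rw [sample]; congr 1; push_cast; ring
  have ed : sample s u ε (0 + 2) = s (u + 3 * ε) := by
    rw [sample]; congr 2; push_cast; ring
  rw [ea, eb, ec, ed]
  dsimp only [sampleData]
  refine ⟨?_, ?_, ?_, ?_⟩ <;> match_scalars <;> field_simp <;> ring

end DiscreteTorsion

end

theorem mainTheorem3 (s : ℝ → DiscreteTorsion.E3) (hs : ContDiff ℝ 5 s) (u : ℝ)
    (hκ : DiscreteTorsion.curvature s u ≠ 0) :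
    (∀ᶠ ε in 𝓝[≠] (0 : ℝ),
      DiscreteTorsion.CurvatureCircleDefined (DiscreteTorsion.sample s u ε) 0) ∧
    (fun ε : ℝ => DiscreteTorsion.discreteTorsion (DiscreteTorsion.sample s u ε) 0
        - DiscreteTorsion.torsion s u) =O[𝓝[≠] (0 : ℝ)] (fun ε : ℝ => ε ^ 2) := by
  have hcr : DiscreteTorsion.cross (deriv s u) ((4 : ℝ) • iteratedDeriv 2 s u) ≠ 0 := by
    rw [DiscreteTorsion.cross_smul_right]
    refine smul_ne_zero four_ne_zero fun h => hκ ?_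
    rw [DiscreteTorsion.curvature, h, norm_zero, zero_div]
  set P := deriv s u
  set R := (4 / 3 : ℝ) • iteratedDeriv 3 s u
  set g := (4 : ℝ) • iteratedDeriv 2 s u
  have hXO := DiscreteTorsion.sampleData_sub_isBigO hs u
  have hsq : Filter.Tendsto (fun ε : ℝ => ε ^ 2) (𝓝[≠] 0) (𝓝 0) := by
    have : Continuous fun ε : ℝ => ε ^ 2 := by fun_prop
    simpa using (this.tendsto 0).mono_left nhdsWithin_le_nhds
  have hX : Filter.Tendsto (DiscreteTorsion.sampleData s u) (𝓝[≠] 0) (𝓝 (P, R, g, 0)) :=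
    tendsto_sub_nhds_zero_iff.1 (hXO.trans_tendsto hsq)
  obtain ⟨V, hV, hV0, hV1⟩ :=
    DiscreteTorsion.exists_implicit_pBC (DiscreteTorsion.left_ne_zero_of_cross hcr) R g
  have hadm := DiscreteTorsion.eventually_admissible hcr hV.continuousAt hV0 hV1 hX fun _ => rfl
  have hne : ∀ᶠ ε in 𝓝[≠] (0 : ℝ), ε ≠ 0 := self_mem_nhdsWithin
  refine ⟨?_, ?_⟩
  · filter_upwards [hadm, hne] with ε h hε
    obtain ⟨E, ha, hb, hc, hd⟩ := DiscreteTorsion.exists_sample_eq s u hε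
    exact (h.curvatureCircle ha hb hc hd).1
  have hZd : DifferentiableAt ℝ (fun x => (x, V x)) (P, R, g, 0) := differentiableAt_id.prodMk hV
  have hE : DifferentiableAt ℝ (fun x => DiscreteTorsion.torsionEven (x, V x)) (P, R, g, 0) := by
    refine DifferentiableAt.comp (g := DiscreteTorsion.torsionEven) _ ?_ hZd
    rw [hV0]
    exact DiscreteTorsion.differentiableAt_torsionEven hcr R
  have hO : DifferentiableAt ℝ (fun x => DiscreteTorsion.torsionOdd (x, V x)) (P, R, g, 0) := by
    refine DifferentiableAt.comp (g := DiscreteTorsion.torsionOdd) _ ?_ hZd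
    rw [hV0]
    exact DiscreteTorsion.differentiableAt_torsionOdd hcr R
  -- Both parts are differentiable in data that are `O(ε²)`-close to the limit; the odd part
  -- vanishes there, so it contributes even less.
  have hE' := (hE.isBigO_sub.comp_tendsto hX).trans hXO
  have hO' := (hO.isBigO_sub.comp_tendsto hX).trans hXO
  dsimp only [Function.comp_def] at hE' hO'
  rw [hV0, DiscreteTorsion.torsionEven_zero hcr, DiscreteTorsion.limit_torsion_eq] at hE'
  rw [hV0, DiscreteTorsion.torsionOdd_zero (DiscreteTorsion.left_ne_zero_of_cross hcr)] at hO'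
  have hid : (fun ε : ℝ => ε) =O[𝓝[≠] (0 : ℝ)] fun _ => (1 : ℝ) :=
    (Filter.tendsto_id.mono_left nhdsWithin_le_nhds).isBigO_one ℝ
  have hO'' := hid.mul hO'
  simp only [one_mul, sub_zero] at hO''
  refine (hE'.add hO'').congr' ?_ .rfl
  filter_upwards [hadm, hne] with ε h hε
  obtain ⟨E, ha, hb, hc, hd⟩ := DiscreteTorsion.exists_sample_eq s u hε
  rw [h.discreteTorsion_eq rfl ha hb hc hd]
  ring
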